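/- Theorem 4. Let $N\ge 1$ agents $\mathcal N=\{1,\dots,N\}$ have private costs $J_i(x,\theta)$, $x\in\mathbb R$, depending on a parameter $\theta$ in a finite set $\Theta=\{\theta_1,\dots,\theta_M\}$ with unknown true value $\theta_*\in\Theta$, and let $f_i(\cdot\,|\,x,\theta)>0$ be the likelihood (probability density on $\mathbb R$) of the observation of agent $i$ at decision $x$ under $\theta$. Let $W=[w_{ij}]$ be the weight matrix of a network and $\{\alpha^{(t)}\}_{t\ge0}$ a stepsize sequence. From arbitrary (possibly random) initial decisions $x_i^{(0)}$ and data $y_i^{(0)}$ and uniform priors $q_i^{(0)}(\theta)=1/M$, the agents compute for $t=0,1,2,\dots$ $$b_i^{(t)}(\theta)=\frac{f_i(y_i^{(t)}|x_i^{(t)},\theta)^{\alpha^{(t)}}q_i^{(t)}(\theta)}{\sum_{\theta'\in\Theta}f_i(y_i^{(t)}|x_i^{(t)},\theta')^{\alpha^{(t)}}q_i^{(t)}(\theta')},\qquad q_i^{(t+1)}(\theta)=\frac{\exp\big(\sum_{j}w_{ij}\log b_j^{(t)}(\theta)\big)}{\sum_{\theta'\in\Theta}\exp\big(\sum_{j}w_{ij}\log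 b_j^{(t)}(\theta')\big)},$$ $$x_i^{(t+1)}=\sum_{j}w_{ij}\Big[x_j^{(t)}-\alpha^{(t)}\sum_{\theta\in\Theta}q_j^{(t+1)}(\theta)\,\tfrac{\partial}{\partial x}J_j(x_j^{(t)},\theta)\Big],\qquad y_i^{(t+1)}=J_i(x_i^{(t+1)},\theta_*)+\epsilon_i^{(t+1)},$$ where the random noise $\epsilon_i^{(t+1)}$ is such that, conditionally on $x_j^{(s)}$ ($s\le t+1$) and $y_j^{(s)}$ ($s\le t$), $j\in\mathcal N$, the observation $y_i^{(t+1)}$ has density $f_i(\cdot\,|\,x_i^{(t+1)},\theta_*)$. Assume: 1. There is a constant $B>0$ with $\big|\log\frac{f_i(y|x,\theta')}{f_i(y|x,\theta'')}\big|<B$ for all $i,x,y,\theta',\theta''$, and $f_i(y|x,\theta)$ is continuous in $x$. 2. The network is static, undirected and connected, $W$ is nonnegative and doubly stochastic, and $w_{ij}>0$ exactly when $i$ and $j$ are neighbours ($w_{ii}>0$ meaning a self-loop at $i$); the network with its self-loops is not bipartite (for instance, some $w_{ii}>0$). 3. $0<\alpha^{(t)}<1$, $\sum_t\alpha^{(t)}=\infty$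 and $\sum_t(\alpha^{(t)})^2<\infty$. 4. For all $i$ and $\theta$, $J_i(\cdot,\theta)$ is differentiable, strongly convex with a constant $\mu>0$ and Lipschitz smooth with a constant $L$: $(\nabla_xJ_i(x',\theta)-\nabla_xJ_i(x,\theta))(x'-x)\ge\mu|x'-x|^2$ and $|\nabla_xJ_i(x',\theta)-\nabla_xJ_i(x,\theta)|\le L|x'-x|$ for all $x,x'\in\mathbb R$. 5. For every $\theta\ne\theta_*$ there is an agent $i$ such that $D_{KL}\big(f_i(\cdot|x,\theta_*)\,\|\,f_i(\cdot|x,\theta)\big)=\int f_i(y|x,\theta_*)\log\frac{f_i(y|x,\theta_*)}{f_i(y|x,\theta)}\,dy>0$ for all $x\in\mathbb R$. Suppose moreover that $\alpha^{(t)}=\mathcal O(1/t)$. Then the problem $\min_{x\in\mathbb R}\frac1N\sum_{i=1}^NJ_i(x,\theta_*)$ has a unique optimal solution $x_*$, and almost surely $\lim_{t\to\infty}x_i^{(t)}=x_*$ for every agent $i\in\mathcal N$. -/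

import Mathlib

open MeasureTheory ProbabilityTheory Filter Topology Asymptotics

/-- The global cost `(1/N) ∑ i, J i x θ` under the parameter `θ`. -/
noncomputable def globalCost {N : ℕ} {Θ : Type*} (J : Fin N → ℝ → Θ → ℝ) (θ : Θ) (x : ℝ) : ℝ :=
  (1 / (N : ℝ)) * ∑ i, J i x θ

/-! ### The algorithm

Agents are indexed by `Fin N`, the finite parameter set is `Θ`, `J i x θ` is the cost of agent `i`
and `f i y x θ` is the likelihood of the observation `y` of agent `i` at decision `x` under `θ`.
Sums over the neighbours of `i` are written as sums over all agents: the weight `W i j` is `0`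
when `j` is not a neighbour of `i`. -/

/-- What the agents hold at one iteration: decisions, observed data, private beliefs. -/
structure AgentState (N : ℕ) (Θ : Type*) where
  x : Fin N → ℝ
  y : Fin N → ℝ
  q : Fin N → Θ → ℝ

/-- Local fractional Bayesian posterior with exponent `a`. -/
noncomputable def fractionalPosterior {N : ℕ} {Θ : Type*} [Fintype Θ]
    (f : Fin N → ℝ → ℝ → Θ → ℝ) (a : ℝ) (s : AgentState N Θ) (i : Fin N) (θ : Θ) : ℝ :=
  (f i (s.y i) (s.x i) θ) ^ a * s.q i θ / ∑ θ', (f i (s.y i) (s.x i) θ') ^ a * s.q i θ'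

/-- Weighted averaging of the log-beliefs, followed by normalization. -/
noncomputable def logBeliefConsensus {N : ℕ} {Θ : Type*} [Fintype Θ]
    (W : Matrix (Fin N) (Fin N) ℝ) (b : Fin N → Θ → ℝ) (i : Fin N) (θ : Θ) : ℝ :=
  Real.exp (∑ j, W i j * Real.log (b j θ)) / ∑ θ', Real.exp (∑ j, W i j * Real.log (b j θ'))

/-- The cost of agent `i` averaged over its belief. -/
noncomputable def expectedCost {N : ℕ} {Θ : Type*} [Fintype Θ]
    (J : Fin N → ℝ → Θ → ℝ) (q : Fin N → Θ → ℝ) (i : Fin N) (x : ℝ) : ℝ :=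
  ∑ θ, J i x θ * q i θ

/-- Local gradient descent with stepsize `a`, followed by linear consensus. -/
noncomputable def decisionUpdate {N : ℕ} {Θ : Type*} [Fintype Θ]
    (J : Fin N → ℝ → Θ → ℝ) (W : Matrix (Fin N) (Fin N) ℝ) (a : ℝ)
    (x : Fin N → ℝ) (q : Fin N → Θ → ℝ) (i : Fin N) : ℝ :=
  ∑ j, W i j * (x j - a * deriv (expectedCost J q j) (x j))

/-- The states produced by the algorithm from the initial decisions `x₀`, the initial data `y₀`,
uniform prior beliefs and the noise sequence `ε` (`ε 0` is not used): new beliefs, then new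
decisions computed with the new beliefs, then new data `J i x θs + ε` under the true
parameter `θs`. -/
noncomputable def algorithmRun {N : ℕ} {Θ : Type*} [Fintype Θ]
    (J : Fin N → ℝ → Θ → ℝ) (f : Fin N → ℝ → ℝ → Θ → ℝ) (θs : Θ)
    (W : Matrix (Fin N) (Fin N) ℝ) (α : ℕ → ℝ)
    (x₀ y₀ : Fin N → ℝ) (ε : ℕ → Fin N → ℝ) : ℕ → AgentState N Θ
  | 0 => ⟨x₀, y₀, fun _ _ => 1 / (Fintype.card Θ : ℝ)⟩
  | t + 1 =>
    let s := algorithmRun J f θs W α x₀ y₀ ε t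
    let q' := logBeliefConsensus W (fractionalPosterior f (α t) s)
    let x' := decisionUpdate J W (α t) s.x q'
    ⟨x', fun i => J i (x' i) θs + ε (t + 1) i, q'⟩

/-! ### Probabilistic model -/

/-- The functions `y ↦ f i y x θ` are probability densities on `ℝ` that are positive
(so that their log-ratios are defined). -/
structure IsLikelihood {N : ℕ} {Θ : Type*} (f : Fin N → ℝ → ℝ → Θ → ℝ) : Prop where
  measurable : ∀ i x θ, Measurable fun y => f i y x θ
  pos : ∀ i y x θ, 0 < f i y x θ
  integral_eq_one : ∀ i x θ, ∫ y, f i y x θ = 1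

/-- The information available when the data of iteration `t` are drawn: all decisions up to
iteration `t` and all data of earlier iterations. -/
abbrev historyBefore {Ω : Type*} {N : ℕ} {Θ : Type*} (S : ℕ → Ω → AgentState N Θ) (t : ℕ) :
    MeasurableSpace Ω :=
  (⨆ (s : ℕ) (_ : s ≤ t), MeasurableSpace.comap (fun ω => (S s ω).x) inferInstance) ⊔
    ⨆ (s : ℕ) (_ : s < t), MeasurableSpace.comap (fun ω => (S s ω).y) inferInstance

/-- For `t ≥ 1`, given the past, the datum of agent `i` at iteration `t` has density
`f i · x θs`, where `x` is its current decision and `θs` is the true parameter. -/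
def DataFollowLikelihood {Ω : Type*} [MeasurableSpace Ω] (μ : Measure Ω) {N : ℕ} {Θ : Type*}
    (f : Fin N → ℝ → ℝ → Θ → ℝ) (θs : Θ) (S : ℕ → Ω → AgentState N Θ) : Prop :=
  ∀ t : ℕ, 1 ≤ t → ∀ (i : Fin N) (A : Set ℝ), MeasurableSet A →
    μ⟦(fun ω => (S t ω).y i) ⁻¹' A | historyBefore S t⟧
      =ᵐ[μ] fun ω => ∫ v in A, f i v ((S t ω).x i) θs

/-! ### The five assumptions -/

/-- Uniformly bounded log-likelihood ratios, and likelihoods continuous in the decision. -/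
structure BoundedBelief {N : ℕ} {Θ : Type*} (f : Fin N → ℝ → ℝ → Θ → ℝ) : Prop where
  bounded : ∃ B : ℝ, 0 < B ∧
    ∀ i θ' θ'' x y, |Real.log (f i y x θ' / f i y x θ'')| < B
  continuous : ∀ i y θ, Continuous fun x => f i y x θ

/-- The network: `G` is an undirected connected graph on the agents, `W` is (entrywise nonnegative
and) doubly stochastic, and distinct agents are neighbours exactly when their weight is positive.
A positive diagonal weight `W i i` is a self-loop at `i`. The network with its self-loops is not
bipartite (otherwise the powers of `W` do not converge). -/
structure NetworkAssumption {N : ℕ} (G : SimpleGraph (Fin N)) (W : Matrix (Fin N) (Fin N) ℝ) :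
    Prop where
  connected : G.Connected
  doublyStochastic : W ∈ doublyStochastic ℝ (Fin N)
  pos_iff_adj : ∀ i j, i ≠ j → (0 < W i j ↔ G.Adj i j)
  not_bipartite : (∃ i, 0 < W i i) ∨ ¬ G.IsBipartite

/-- The stepsize policy. -/
structure StepsizePolicy (α : ℕ → ℝ) : Prop where
  pos : ∀ t, 0 < α t
  lt_one : ∀ t, α t < 1
  sum_eq_top : Tendsto (fun T => ∑ t ∈ Finset.range T, α t) atTop atTop
  sum_sq : Summable fun t => α t ^ 2

/-- The costs are differentiable in the decision, strongly convex with a constant `m > 0` and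
Lipschitz smooth with a constant `L`. -/
structure CostAssumption {N : ℕ} {Θ : Type*} (J : Fin N → ℝ → Θ → ℝ) (m L : ℝ) : Prop where
  pos : 0 < m
  differentiable : ∀ i θ, Differentiable ℝ fun x => J i x θ
  strongly_convex : ∀ i θ x x',
    m * |x' - x| ^ 2 ≤ (deriv (fun z => J i z θ) x' - deriv (fun z => J i z θ) x) * (x' - x)
  smooth : ∀ i θ x x',
    |deriv (fun z => J i z θ) x' - deriv (fun z => J i z θ) x| ≤ L * |x' - x|

/-- The Kullback-Leibler divergence of two densities on the real line. -/
noncomputable def densityKL (g h : ℝ → ℝ) : ℝ :=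
  ∫ y, g y * Real.log (g y / h y)

/-- Every wrong parameter is told apart from the true one by some agent, at all decisions. -/
def IdentifiableParameter {N : ℕ} {Θ : Type*} (f : Fin N → ℝ → ℝ → Θ → ℝ) (θs : Θ) : Prop :=
  ∀ θ, θ ≠ θs → ∃ i, ∀ x, 0 < densityKL (fun y => f i y x θs) (fun y => f i y x θ)

/-! Learning and optimization separate. For a wrong `θ`, put `Λ i = log (q i θ / q i θs)`.
Normalizations cancel, so `Λ` obeys the linear recursion `Λ (t+1) = W (Λ t + α t * ℓ t)`, where `ℓ`
is the log-likelihood ratio of the current data. Since `W` is doubly stochastic, the sum of `Λ` over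
the agents just accumulates `α t * ℓ t j`. The conditional mean of `ℓ t j` is minus a
Kullback-Leibler divergence. The centred part is a martingale with bounded differences and
square-summable weights, hence converges almost surely (`ae_exists_tendsto_sum_logRatio`). Along
each run the decisions stay bounded, whatever the beliefs (`exists_abs_algorithmRun_x_le`), so the
identifying agent's divergence is bounded below (`exists_le_densityKL`). As `∑ α = ∞`, the sum of
`Λ` tends to `-∞`.

Individual agents follow the average: `W` contracts zero-sum vectors strictly and the perturbations
`α t * ℓ t` vanish (`tendsto_sub_average`). Hence every agent's belief in `θ` tends to zero
(`tendsto_algorithmRun_q_zero`).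

Once beliefs concentrate on `θs`, the decisions reach consensus for the same reason, and their mean
performs gradient descent on the true global cost with vanishing gradient error. Strong convexity
makes each step contract by `1 - α t * m`, and `∑ α = ∞` drives the mean to the minimizer
(`tendsto_algorithmRun_x`). Only the martingale convergence is probabilistic; the rest is pathwise.
-/

/-! ### Deterministic recursions -/

/-- Once `e < δ / 2`, the excess of `a` over `δ / 2` shrinks by `1 - γ t ≤ exp (-γ t)` at each step,
and divergence of `∑ γ` sends the product of these factors to zero. -/
theorem tendsto_zero_of_le_convex_combination {a γ e : ℕ → ℝ} (ha : ∀ t, 0 ≤ a t)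
    (hγ1 : ∀ᶠ t in atTop, γ t ≤ 1)
    (hγ : Tendsto (fun T => ∑ t ∈ Finset.range T, γ t) atTop atTop)
    (hγ0 : ∀ t, 0 ≤ γ t) (he : Tendsto e atTop (𝓝 0))
    (h : ∀ᶠ t in atTop, a (t + 1) ≤ (1 - γ t) * a t + γ t * e t) :
    Tendsto a atTop (𝓝 0) := by
  refine Metric.tendsto_atTop.2 fun δ hδ => ?_
  obtain ⟨T, hT⟩ := eventually_atTop.1
    ((hγ1.and h).and (he.eventually (gt_mem_nhds (half_pos hδ))))
  set c : ℕ → ℝ := fun t => max (a t - δ / 2) 0 with hc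
  have hstep : ∀ t, T ≤ t → c (t + 1) ≤ Real.exp (-γ t) * c t := by
    intro t ht
    obtain ⟨⟨h1, h2⟩, h3⟩ := hT t ht
    have hc0 : 0 ≤ c t := le_max_right _ _
    have hca : a t - δ / 2 ≤ c t := le_max_left _ _
    have hexp : 1 - γ t ≤ Real.exp (-γ t) := by linarith [Real.add_one_le_exp (-γ t)]
    refine le_trans (b := (1 - γ t) * c t) (max_le ?_ ?_) (by gcongr)
    · nlinarith [hγ0 t, mul_le_mul_of_nonneg_left h3.le (hγ0 t),
        mul_le_mul_of_nonneg_left hca (sub_nonneg.2 h1)]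
    · exact mul_nonneg (sub_nonneg.2 h1) hc0
  set Γ : ℕ → ℝ := fun n => ∑ t ∈ Finset.range n, γ t with hΓ
  have hbound : ∀ t, T ≤ t → c t ≤ Real.exp (Γ T - Γ t) * c T := by
    intro t ht
    induction t, ht using Nat.le_induction with
    | base => simp
    | succ t ht ih =>
      have : Γ T - Γ (t + 1) = -γ t + (Γ T - Γ t) := by
        simp only [hΓ, Finset.sum_range_succ]; ring
      rw [this, Real.exp_add, mul_assoc]
      exact (hstep t ht).trans (by gcongr)
  have hlim : Tendsto (fun t => Real.exp (Γ T - Γ t) * c T) atTop (𝓝 0) := by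
    rw [← zero_mul (c T)]
    refine Tendsto.mul_const _ (Real.tendsto_exp_atBot.comp ?_)
    exact tendsto_atBot_add_const_left _ _ (tendsto_neg_atTop_atBot.comp hγ)
  obtain ⟨T', hT'⟩ := eventually_atTop.1 (hlim.eventually (gt_mem_nhds (half_pos hδ)))
  refine ⟨max T T', fun t ht => ?_⟩
  have h1 := hbound t (le_of_max_le_left ht)
  have h2 := hT' t (le_of_max_le_right ht)
  have h3 : a t - δ / 2 ≤ c t := le_max_left _ _
  rw [Real.dist_eq, sub_zero, abs_of_nonneg (ha t)]
  linarith

/-- For `d = x - y > 0` the increment of `h` lies between `m * d` and `L * d`; `a * L ≤ 1` prevents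
overshooting, so the lower bound alone governs the new distance. -/
theorem abs_gradient_step_sub_le {h : ℝ → ℝ} {m L a x y : ℝ} (ha : 0 ≤ a) (haL : a * L ≤ 1)
    (hmono : m * |x - y| ^ 2 ≤ (h x - h y) * (x - y)) (hlip : |h x - h y| ≤ L * |x - y|) :
    |(x - a * h x) - (y - a * h y)| ≤ (1 - a * m) * |x - y| := by
  have key : ∀ d D : ℝ, 0 < d → m * d ^ 2 ≤ D * d → D ≤ L * d →
      |d - a * D| ≤ (1 - a * m) * d := by
    intro d D hd h1 h2
    have h1' : m * d ≤ D := by nlinarith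
    rw [abs_of_nonneg (by nlinarith)]
    nlinarith
  rw [show (x - a * h x) - (y - a * h y) = (x - y) - a * (h x - h y) by ring]
  rcases lt_trichotomy (x - y) 0 with hd | hd | hd
  · rw [abs_of_neg hd] at *
    have := key (-(x - y)) (-(h x - h y)) (by linarith) (by linarith)
      ((neg_le_abs _).trans hlip)
    rw [← abs_neg]
    convert this using 2
    ring
  · have hD : |h x - h y| ≤ 0 := by simpa [hd] using hlip
    rw [abs_nonpos_iff.1 hD, hd]
    simp
  · rw [abs_of_pos hd] at *
    exact key _ _ hd hmono ((le_abs_self _).trans hlip)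

/-! ### Consensus -/

theorem sum_mul_sum_of_mem_doublyStochastic {N : ℕ} {W : Matrix (Fin N) (Fin N) ℝ}
    (hW : W ∈ doublyStochastic ℝ (Fin N)) (x : Fin N → ℝ) :
    ∑ i, ∑ j, W i j * x j = ∑ j, x j := by
  rw [Finset.sum_comm]
  simp [← Finset.sum_mul, sum_col_of_mem_doublyStochastic hW]

/-- Each row is a probability vector, and the right side sums the row variances of `x`. Column sums
equal to one turn the row means of squares into `∑ x j ^ 2`. -/
theorem sum_sq_sub_sum_sq_of_mem_doublyStochastic {N : ℕ} {W : Matrix (Fin N) (Fin N) ℝ}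
    (hW : W ∈ doublyStochastic ℝ (Fin N)) (x : Fin N → ℝ) :
    ∑ j, x j ^ 2 - ∑ i, (∑ j, W i j * x j) ^ 2
      = ∑ i, ∑ j, W i j * (x j - ∑ k, W i k * x k) ^ 2 := by
  rw [← sum_mul_sum_of_mem_doublyStochastic hW fun j => x j ^ 2, ← Finset.sum_sub_distrib]
  refine Finset.sum_congr rfl fun i _ => ?_
  set y := ∑ k, W i k * x k with hy
  have h1 : ∀ j, W i j * (x j - y) ^ 2
      = W i j * x j ^ 2 - 2 * y * (W i j * x j) + y ^ 2 * W i j := fun j => by ring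
  simp only [h1, Finset.sum_add_distrib, Finset.sum_sub_distrib, ← Finset.mul_sum, ← hy,
    sum_row_of_mem_doublyStochastic hW]
  ring

namespace NetworkAssumption

variable {N : ℕ} {G : SimpleGraph (Fin N)} {W : Matrix (Fin N) (Fin N) ℝ}

theorem nonneg (h : NetworkAssumption G W) (i j : Fin N) : 0 ≤ W i j :=
  nonneg_of_mem_doublyStochastic h.doublyStochastic

theorem sum_row (h : NetworkAssumption G W) (i : Fin N) : ∑ j, W i j = 1 :=
  sum_row_of_mem_doublyStochastic h.doublyStochastic i

theorem pos_symm (h : NetworkAssumption G W) {i j : Fin N} (hij : 0 < W i j) : 0 < W j i := by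
  by_cases hne : i = j
  · rwa [← hne] at hij ⊢
  · exact (h.pos_iff_adj j i (Ne.symm hne)).2 ((h.pos_iff_adj i j hne).1 hij).symm

/-- A vector whose entries agree on the neighbourhood of every vertex is constant. -/
theorem eq_of_eq_on_neighbours (h : NetworkAssumption G W) {x : Fin N → ℝ}
    (hx : ∀ i u v, 0 < W i u → 0 < W i v → x u = x v) (u v : Fin N) : x u = x v := by
  have hadj : ∀ {a b}, G.Adj a b → 0 < W a b := fun hab => (h.pos_iff_adj _ _ hab.ne).2 hab
  by_cases hedge : ∀ a b, G.Adj a b → x a = x b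
  · obtain ⟨p⟩ := h.connected.preconnected u v
    induction p with
    | nil => rfl
    | cons hab _ ih => exact (hedge _ _ hab).trans ih
  exfalso
  push Not at hedge
  obtain ⟨a, b, hab, hne⟩ := hedge
  -- An edge with two different values forces alternation along every walk: a vertex takes the value
  -- shared by the neighbours of its predecessor, and its own neighbours all share the predecessor's
  -- value. The two values then form a proper 2-colouring, excluded by a self-loop or by
  -- non-bipartiteness.
  have claim : ∀ w, (x w = x a ∧ ∀ u, 0 < W w u → x u = x b) ∨
      (x w = x b ∧ ∀ u, 0 < W w u → x u = x a) := by
    intro w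
    obtain ⟨p⟩ := h.connected.preconnected w a
    clear u v
    induction p with
    | nil => exact .inl ⟨rfl, fun u hu => hx _ _ _ hu (hadj hab)⟩
    | @cons w w' a hw _ ih =>
      have hback : 0 < W w w' := hadj hw
      rcases ih hab hne with ⟨h1, h2⟩ | ⟨h1, h2⟩
      · exact .inr ⟨h2 w (h.pos_symm hback), fun u hu => (hx _ _ _ hu hback).trans h1⟩
      · exact .inl ⟨h2 w (h.pos_symm hback), fun u hu => (hx _ _ _ hu hback).trans h1⟩
  have hcol : ∀ w w', 0 < W w w' → (x w = x a ↔ ¬ x w' = x a) := by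
    intro w w' hw
    rcases claim w with ⟨h1, h2⟩ | ⟨h1, h2⟩
    · simp [h1, h2 w' hw, hne.symm]
    · simp [h1, h2 w' hw, hne.symm]
  rcases h.not_bipartite with ⟨i, hi⟩ | hb
  · have := hcol i i hi
    tauto
  · classical
    refine hb ⟨SimpleGraph.Coloring.mk (fun w => if x w = x a then 0 else 1) ?_⟩
    intro w w' hw
    have := hcol w w' (hadj hw)
    by_cases h1 : x w = x a <;> by_cases h2 : x w' = x a <;> simp_all

/-- Equality would make every row variance zero, so `x` would be constant on neighbourhoods, hence
constant, hence zero. -/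
theorem sum_sq_lt (h : NetworkAssumption G W) {x : Fin N → ℝ} (hx : ∑ j, x j = 0)
    (hx0 : x ≠ 0) : ∑ i, (∑ j, W i j * x j) ^ 2 < ∑ j, x j ^ 2 := by
  have hkey := sum_sq_sub_sum_sq_of_mem_doublyStochastic h.doublyStochastic x
  have hterm : ∀ i j, 0 ≤ W i j * (x j - ∑ k, W i k * x k) ^ 2 := fun i j =>
    mul_nonneg (h.nonneg i j) (sq_nonneg _)
  have hge : 0 ≤ ∑ i, ∑ j, W i j * (x j - ∑ k, W i k * x k) ^ 2 :=
    Finset.sum_nonneg fun i _ => Finset.sum_nonneg fun j _ => hterm i j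
  rcases hge.lt_or_eq with hlt | heq
  · linarith
  exfalso
  have hzero : ∀ i j, W i j * (x j - ∑ k, W i k * x k) ^ 2 = 0 := by
    intro i j
    have h1 := (Finset.sum_eq_zero_iff_of_nonneg
      fun i _ => Finset.sum_nonneg fun j _ => hterm i j).1 heq.symm i (Finset.mem_univ _)
    exact (Finset.sum_eq_zero_iff_of_nonneg fun j _ => hterm i j).1 h1 j (Finset.mem_univ _)
  have hval : ∀ i j, 0 < W i j → x j = ∑ k, W i k * x k := by
    intro i j hij
    have := (mul_eq_zero.1 (hzero i j)).resolve_left hij.ne'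
    linarith [pow_eq_zero_iff (two_ne_zero) |>.1 this]
  have hconst := h.eq_of_eq_on_neighbours (x := x)
    fun i u v hu hv => (hval i u hu).trans (hval i v hv).symm
  refine hx0 (funext fun i => ?_)
  have hN : (N : ℝ) ≠ 0 := Nat.cast_ne_zero.2 (Fin.pos i).ne'
  rw [Finset.sum_congr rfl fun j _ => hconst j i] at hx
  simpa [hN] using hx

/-- On vectors with zero sum, one averaging step is a strict contraction. -/
theorem exists_contraction (h : NetworkAssumption G W) :
    ∃ ρ : ℝ, 0 ≤ ρ ∧ ρ < 1 ∧ ∀ x : Fin N → ℝ, ∑ j, x j = 0 →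
      ‖WithLp.toLp 2 fun i => ∑ j, W i j * x j‖ ≤ ρ * ‖WithLp.toLp 2 x‖ := by
  set A : EuclideanSpace ℝ (Fin N) → EuclideanSpace ℝ (Fin N) :=
    fun x => WithLp.toLp 2 fun i => ∑ j, W i j * x j with hA
  have hAc : Continuous A := by
    refine (PiLp.continuous_toLp 2 _).comp ?_
    fun_prop
  -- Compactness turns the pointwise strict inequality into a uniform `ρ < 1`; homogeneity then
  -- extends it to all zero-sum vectors. `S` is empty for a single agent.
  set S : Set (EuclideanSpace ℝ (Fin N)) := Metric.sphere 0 1 ∩ {x | ∑ j, x j = 0} with hS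
  have hSc : IsCompact S := (isCompact_sphere 0 1).inter_right
    (isClosed_eq (by fun_prop) continuous_const)
  have hlt : ∀ x ∈ S, ‖A x‖ < 1 := by
    rintro x ⟨hx1, hx2⟩
    have hx1 : ‖x‖ = 1 := by simpa using hx1
    rw [← hx1, EuclideanSpace.norm_eq, EuclideanSpace.norm_eq]
    simp only [Real.norm_eq_abs, sq_abs]
    refine Real.sqrt_lt_sqrt (Finset.sum_nonneg fun _ _ => sq_nonneg _) (h.sum_sq_lt hx2 ?_)
    intro h0
    have : x = 0 := by ext i; exact congrFun h0 i
    simp [this] at hx1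
  obtain ⟨ρ, hρ0, hρ1, hρ⟩ : ∃ ρ : ℝ, 0 ≤ ρ ∧ ρ < 1 ∧ ∀ x ∈ S, ‖A x‖ ≤ ρ := by
    rcases S.eq_empty_or_nonempty with hE | hE
    · exact ⟨0, le_rfl, one_pos, by simp [hE]⟩
    · obtain ⟨x, hx, hmax⟩ := hSc.exists_isMaxOn hE (hAc.norm.continuousOn)
      exact ⟨‖A x‖, norm_nonneg _, hlt x hx, fun y hy => hmax hy⟩
  refine ⟨ρ, hρ0, hρ1, fun x hx => ?_⟩
  rcases eq_or_ne (WithLp.toLp 2 x) 0 with h0 | h0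
  · have : x = 0 := by simpa using h0
    subst this
    rw [show (fun i => ∑ j, W i j * (0 : Fin N → ℝ) j) = 0 by ext; simp]
    simp
  set r := ‖WithLp.toLp 2 x‖ with hr
  have hrpos : 0 < r := norm_pos_iff.2 h0
  have hmem : r⁻¹ • WithLp.toLp 2 x ∈ S := by
    refine ⟨?_, ?_⟩
    · simp [norm_smul, ← hr, abs_of_pos hrpos, hrpos.ne']
    · simp [← Finset.mul_sum, hx]
  have hsc : A (r⁻¹ • WithLp.toLp 2 x) = r⁻¹ • WithLp.toLp 2 fun i => ∑ j, W i j * x j := by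
    ext i
    simp only [hA, PiLp.smul_apply, smul_eq_mul, Finset.mul_sum]
    exact Finset.sum_congr rfl fun j _ => by ring
  have := hρ _ hmem
  rw [hsc, norm_smul, Real.norm_eq_abs, abs_of_pos (inv_pos.2 hrpos), inv_mul_le_iff₀ hrpos] at this
  linarith

/-- Repeated averaging of perturbed values, with vanishing perturbations, leads to consensus. -/
theorem tendsto_sub_average (h : NetworkAssumption G W) {z v : ℕ → Fin N → ℝ}
    (hz : ∀ t i, z (t + 1) i = ∑ j, W i j * (z t j + v t j))
    (hv : ∀ j, Tendsto (fun t => v t j) atTop (𝓝 0)) (i : Fin N) :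
    Tendsto (fun t => z t i - (∑ j, z t j) / N) atTop (𝓝 0) := by
  obtain ⟨ρ, hρ0, hρ1, hρ⟩ := h.exists_contraction
  have hN : (N : ℝ) ≠ 0 := Nat.cast_ne_zero.2 (Fin.pos i).ne'
  set e : ℕ → EuclideanSpace ℝ (Fin N) :=
    fun t => WithLp.toLp 2 fun i => z t i - (∑ j, z t j) / N with he
  set d : ℕ → EuclideanSpace ℝ (Fin N) :=
    fun t => WithLp.toLp 2 fun i => v t i - (∑ j, v t j) / N with hd
  have hd0 : Tendsto (fun t => ‖d t‖) atTop (𝓝 0) := by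
    have h1 : Tendsto (fun t => fun i => v t i - (∑ j, v t j) / N) atTop (𝓝 (0 : Fin N → ℝ)) := by
      refine tendsto_pi_nhds.2 fun i => ?_
      have := (hv i).sub ((tendsto_finsetSum Finset.univ fun j _ => hv j).div_const (N : ℝ))
      simpa using this
    have h2 := ((PiLp.continuous_toLp 2 fun _ : Fin N => ℝ).tendsto 0).comp h1
    simpa using h2.norm
  -- `W` preserves both sums and constants, so the deviations from the mean obey the same recursion
  -- within the zero-sum vectors.
  have hstep : ∀ t, ‖e (t + 1)‖ ≤ ρ * (‖e t‖ + ‖d t‖) := by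
    intro t
    have hsum : ∑ j, z (t + 1) j = ∑ j, (z t j + v t j) := by
      simp only [hz, sum_mul_sum_of_mem_doublyStochastic h.doublyStochastic]
    have heq : e (t + 1) = WithLp.toLp 2 fun i => ∑ j, W i j * (e t + d t) j := by
      ext i
      have hk : ∀ j, W i j * (e t + d t) j
          = W i j * (z t j + v t j) - W i j * ((∑ j, (z t j + v t j)) / N) := by
        intro j
        simp only [he, hd, PiLp.add_apply, Finset.sum_add_distrib]
        ring
      simp only [hk, Finset.sum_sub_distrib, ← Finset.sum_mul, h.sum_row, one_mul]
      simp only [he, hz, sum_mul_sum_of_mem_doublyStochastic h.doublyStochastic]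
    have hz0 : ∑ j, (e t + d t) j = 0 := by
      simp only [he, hd, PiLp.add_apply, Finset.sum_add_distrib, Finset.sum_sub_distrib,
        Finset.sum_const, Finset.card_univ, Fintype.card_fin, nsmul_eq_mul]
      field_simp
      ring
    rw [heq]
    refine (hρ _ hz0).trans ?_
    gcongr
    exact norm_add_le _ _
  have hlim : Tendsto (fun t => ‖e t‖) atTop (𝓝 0) := by
    refine tendsto_zero_of_le_convex_combination (γ := fun _ => 1 - ρ)
      (e := fun t => ρ / (1 - ρ) * ‖d t‖) (fun _ => norm_nonneg _) ?_ ?_ ?_ ?_ ?_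
    · exact .of_forall fun _ => by linarith
    · simp only [Finset.sum_const, Finset.card_range, nsmul_eq_mul]
      exact tendsto_natCast_atTop_atTop.atTop_mul_const (by linarith)
    · exact fun _ => by linarith
    · simpa using hd0.const_mul (ρ / (1 - ρ))
    · refine .of_forall fun t => (hstep t).trans (le_of_eq ?_)
      have : (1 - ρ) ≠ 0 := by linarith
      field_simp
      ring
  refine squeeze_zero_norm (fun t => ?_) hlim
  exact PiLp.norm_apply_le (e t) i

end NetworkAssumption

/-! ### Weighted sums of bounded martingale differences -/

/-- The partial sums form a martingale with orthogonal increments, so their second moments are at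
most `C ^ 2 * ∑ α ^ 2`. Boundedness in `L¹` follows from `|M| ≤ 1 + M ^ 2`, and Doob's convergence
theorem applies. -/
theorem ae_exists_tendsto_sum_of_condExp_eq_zero {Ω : Type*} {m0 : MeasurableSpace Ω}
    {μ : Measure Ω} [IsProbabilityMeasure μ] {ℱ : Filtration ℕ m0} {d : ℕ → Ω → ℝ} {α : ℕ → ℝ}
    {C : ℝ} (hd : ∀ t, StronglyMeasurable[ℱ (t + 1)] (d t)) (hC : ∀ t ω, |d t ω| ≤ C)
    (hcond : ∀ t, μ[d t | ℱ t] =ᵐ[μ] 0) (hα : Summable fun t => α t ^ 2) :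
    ∀ᵐ ω ∂μ, ∃ l, Tendsto (fun n => ∑ t ∈ Finset.range n, α t * d t ω) atTop (𝓝 l) := by
  set M : ℕ → Ω → ℝ := fun n ω => ∑ t ∈ Finset.range n, α t * d t ω with hM
  have hMsucc : ∀ n, M (n + 1) = M n + α n • d n := by
    intro n
    ext ω
    simp [hM, Finset.sum_range_succ]
  have hdint : ∀ t, Integrable (d t) μ := fun t =>
    .of_bound ((hd t).mono (ℱ.le _)).aestronglyMeasurable C (.of_forall (hC t))
  have hMad : StronglyAdapted ℱ M := by
    intro n
    refine Finset.stronglyMeasurable_fun_sum _ fun t ht => ?_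
    have hlt : t + 1 ≤ n := Finset.mem_range.1 ht
    exact ((hd t).mono (ℱ.mono hlt)).const_mul (α t)
  have hMb : ∀ n ω, |M n ω| ≤ ∑ t ∈ Finset.range n, |α t| * C := by
    intro n ω
    refine (Finset.abs_sum_le_sum_abs _ _).trans (Finset.sum_le_sum fun t _ => ?_)
    rw [abs_mul]
    exact mul_le_mul_of_nonneg_left (hC t ω) (abs_nonneg _)
  have hMsm : ∀ n, StronglyMeasurable (M n) := fun n => (hMad n).mono (ℱ.le n)
  have hMint : ∀ n, Integrable (M n) μ := fun n =>
    .of_bound (hMsm n).aestronglyMeasurable _ (.of_forall (hMb n))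
  have hmart : Martingale M ℱ μ := by
    refine martingale_of_condExp_sub_eq_zero_nat hMad hMint fun n => ?_
    rw [hMsucc, add_sub_cancel_left]
    filter_upwards [condExp_smul (α n) (d n) (ℱ n) (μ := μ), hcond n] with ω h1 h2
    simp [h1, h2]
  have hsqint : ∀ n, Integrable (fun ω => M n ω ^ 2) μ := by
    intro n
    refine .of_bound ((hMsm n).pow 2).aestronglyMeasurable
      ((∑ t ∈ Finset.range n, |α t| * C) ^ 2) (.of_forall fun ω => ?_)
    rw [Real.norm_eq_abs, abs_pow]
    exact pow_le_pow_left₀ (abs_nonneg _) (hMb n ω) 2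
  have hMdint : ∀ n, Integrable (M n * d n) μ := fun n =>
    (hdint n).bdd_mul (hMsm n).aestronglyMeasurable (.of_forall (hMb n))
  have horth : ∀ n, ∫ ω, M n ω * d n ω ∂μ = 0 := by
    intro n
    have h1 : μ[M n * d n | ℱ n] =ᵐ[μ] 0 := by
      filter_upwards [condExp_stronglyMeasurable_mul_of_bound (ℱ.le n) (hMad n) (hdint n) _
        (.of_forall (hMb n)), hcond n] with ω h1 h2
      simp [h1, h2]
    have h2 := integral_condExp (ℱ.le n) (f := M n * d n) (μ := μ)
    rw [integral_congr_ae h1] at h2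
    simpa using h2.symm
  have hdsq : ∀ n, Integrable (fun ω => d n ω ^ 2) μ := by
    intro n
    refine .of_bound (((hd n).mono (ℱ.le _)).pow 2).aestronglyMeasurable (C ^ 2)
      (.of_forall fun ω => ?_)
    rw [Real.norm_eq_abs, abs_pow]
    exact pow_le_pow_left₀ (abs_nonneg _) (hC n ω) 2
  have hdsq_le : ∀ n, ∫ ω, d n ω ^ 2 ∂μ ≤ C ^ 2 := by
    intro n
    have : ∫ ω, d n ω ^ 2 ∂μ ≤ ∫ _, C ^ 2 ∂μ := by
      refine integral_mono (hdsq n) (integrable_const _) fun ω => ?_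
      exact sq_le_sq' (abs_le.1 (hC n ω)).1 (abs_le.1 (hC n ω)).2
    simpa using this
  have hsq : ∀ n, ∫ ω, M n ω ^ 2 ∂μ ≤ ∑ t ∈ Finset.range n, α t ^ 2 * C ^ 2 := by
    intro n
    induction n with
    | zero => simp [hM]
    | succ n ih =>
      have hexp : ∀ ω, M (n + 1) ω ^ 2
          = M n ω ^ 2 + (2 * α n * (M n ω * d n ω) + α n ^ 2 * d n ω ^ 2) := by
        intro ω
        rw [hMsucc]
        simp only [Pi.add_apply, Pi.smul_apply, smul_eq_mul]
        ring
      simp only [hexp]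
      have hi1 : Integrable (fun ω => 2 * α n * (M n ω * d n ω)) μ := (hMdint n).const_mul _
      have hi2 : Integrable (fun ω => α n ^ 2 * d n ω ^ 2) μ := (hdsq n).const_mul _
      have hi12 : Integrable
          (fun ω => 2 * α n * (M n ω * d n ω) + α n ^ 2 * d n ω ^ 2) μ := hi1.add hi2
      rw [integral_add (hsqint n) hi12, integral_add hi1 hi2, integral_const_mul,
        integral_const_mul, horth, Finset.sum_range_succ]
      have := mul_le_mul_of_nonneg_left (hdsq_le n) (sq_nonneg (α n))
      linarith
  have hbdd : ∀ n, eLpNorm (M n) 1 μ ≤ ((1 + (∑' t, α t ^ 2) * C ^ 2).toNNReal : NNReal) := by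
    intro n
    rw [eLpNorm_one_eq_lintegral_enorm, ← ofReal_integral_norm_eq_lintegral_enorm (hMint n)]
    refine ENNReal.ofReal_le_ofReal ?_
    calc ∫ ω, ‖M n ω‖ ∂μ ≤ ∫ ω, (1 + M n ω ^ 2) ∂μ := by
          refine integral_mono (hMint n).norm ((integrable_const _).add (hsqint n)) fun ω => ?_
          simp only [Real.norm_eq_abs]
          nlinarith [sq_abs (M n ω), sq_nonneg (|M n ω| - 1), abs_nonneg (M n ω)]
      _ = 1 + ∫ ω, M n ω ^ 2 ∂μ := by
          rw [integral_add (integrable_const _) (hsqint n)]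
          simp
      _ ≤ 1 + (∑' t, α t ^ 2) * C ^ 2 := by
          rw [add_le_add_iff_left]
          refine (hsq n).trans ?_
          rw [← Finset.sum_mul]
          gcongr
          exact hα.sum_le_tsum _ fun _ _ => sq_nonneg _
  exact hmart.submartingale.exists_ae_tendsto_of_bdd hbdd

/-! ### Conditional expectations from a conditional density -/

/-- If `Y` has, given `m`, the density `p · X`, then `g (X, Y)` has conditional expectation zero
as soon as `g (x, ·)` has mean zero under `p · x` for all `x`. -/
theorem condExp_eq_zero_of_condDensity {Ω : Type*} {m m0 : MeasurableSpace Ω} {μ : Measure Ω}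
    [IsProbabilityMeasure μ] (hm : m ≤ m0) {X Y : Ω → ℝ} (hX : Measurable[m] X)
    (hY : Measurable Y) {p : ℝ → ℝ → ℝ} (hp : Measurable fun z : ℝ × ℝ => p z.2 z.1)
    (hp0 : ∀ v x, 0 ≤ p v x) (hp1 : ∀ x, Integrable fun v => p v x)
    (hcond : ∀ A : Set ℝ, MeasurableSet A → μ⟦Y ⁻¹' A | m⟧ =ᵐ[μ] fun ω => ∫ v in A, p v (X ω))
    {g : ℝ → ℝ → ℝ} (hg : Measurable fun z : ℝ × ℝ => g z.2 z.1) {C : ℝ}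
    (hgC : ∀ v x, |g v x| ≤ C) (hg0 : ∀ x, ∫ v, p v x * g v x = 0) :
    μ[fun ω => g (Y ω) (X ω) | m] =ᵐ[μ] 0 := by
  have hX' : Measurable X := hX.mono hm le_rfl
  have hXY : Measurable fun ω => (X ω, Y ω) := hX'.prodMk hY
  have hgm : Measurable fun ω => g (Y ω) (X ω) := hg.comp hXY
  have hgint : Integrable (fun ω => g (Y ω) (X ω)) μ :=
    .of_bound hgm.aestronglyMeasurable C (.of_forall fun ω => hgC _ _)
  symm
  refine ae_eq_condExp_of_forall_setIntegral_eq hm hgint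
    (fun s _ _ => (integrable_zero _ _ _).integrableOn) (fun B hB _ => ?_)
    stronglyMeasurable_zero.aestronglyMeasurable
  have hdens : Measurable fun z : ℝ × ℝ => ENNReal.ofReal (p z.2 z.1) := hp.ennreal_ofReal
  set ν := (μ.restrict B).map X with hν
  -- On an event `B` of `m`, the pair `(X, Y)` has density `p` with respect to the law of `X` times
  -- Lebesgue measure. Rectangles suffice: `X ⁻¹' U ∩ B` lies in `m`, so `hcond` can be integrated
  -- over it.
  have hlaw : (μ.restrict B).map (fun ω => (X ω, Y ω))
      = (ν.prod volume).withDensity fun z => ENNReal.ofReal (p z.2 z.1) := by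
    refine Measure.ext_prod fun {U A} hU hA => ?_
    have hD : MeasurableSet[m] (X ⁻¹' U ∩ B) := (hX hU).inter hB
    have hae := hcond A hA
    have hintc : Integrable (fun ω => ∫ v in A, p v (X ω)) μ :=
      integrable_condExp.congr hae
    have hind : Integrable ((Y ⁻¹' A).indicator fun _ => (1 : ℝ)) μ :=
      (integrable_const _).indicator (hY hA)
    have hleft : ((μ.restrict B).map fun ω => (X ω, Y ω)) (U ×ˢ A)
        = μ (Y ⁻¹' A ∩ (X ⁻¹' U ∩ B)) := by
      rw [Measure.map_apply hXY (hU.prod hA),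
        Measure.restrict_apply (hXY (hU.prod hA))]
      congr 1
      ext ω
      simp only [Set.mem_inter_iff, Set.mem_preimage, Set.mem_prod]
      tauto
    have hinner : ∀ x, ∫⁻ v in A, ENNReal.ofReal (p v x) = ENNReal.ofReal (∫ v in A, p v x) :=
      fun x => (ofReal_integral_eq_lintegral_ofReal (hp1 x).integrableOn
        (.of_forall fun v => hp0 v x)).symm
    have hmeas : Measurable fun x => ENNReal.ofReal (∫ v in A, p v x) := by
      simp only [← hinner]
      exact hdens.lintegral_prod_right'
    rw [hleft, withDensity_apply _ (hU.prod hA), setLIntegral_prod _ hdens.aemeasurable]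
    simp only [hinner]
    rw [hν, setLIntegral_map hU hmeas hX', Measure.restrict_restrict (hX' hU),
      ← ofReal_integral_eq_lintegral_ofReal hintc.integrableOn
        (.of_forall fun ω => integral_nonneg fun v => hp0 v _),
      ← setIntegral_congr_ae (hm _ hD) (hae.mono fun ω h _ => h), setIntegral_condExp hm hind hD,
      setIntegral_indicator (hY hA)]
    simp only [integral_const, MeasurableSet.univ, measureReal_restrict_apply, Set.univ_inter,
      smul_eq_mul, mul_one]
    rw [ofReal_measureReal, Set.inter_comm]
  have hfin : ∀ᵐ z ∂(ν.prod volume), ENNReal.ofReal (p z.2 z.1) < ⊤ :=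
    .of_forall fun _ => ENNReal.ofReal_lt_top
  have hmapint : Integrable (fun z : ℝ × ℝ => g z.2 z.1)
      ((μ.restrict B).map fun ω => (X ω, Y ω)) :=
    .of_bound hg.aestronglyMeasurable C (.of_forall fun z => hgC _ _)
  have hint := hmapint
  rw [hlaw, integrable_withDensity_iff_integrable_smul' hdens hfin] at hint
  -- By Fubini the inner integral over the datum is the one that `hg0` annihilates.
  have hcalc : ∫ ω in B, g (Y ω) (X ω) ∂μ = 0 := by
    rw [← integral_map (f := fun z : ℝ × ℝ => g z.2 z.1) hXY.aemeasurable hg.aestronglyMeasurable,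
      hlaw, integral_withDensity_eq_integral_toReal_smul hdens hfin, integral_prod _ hint]
    simp [ENNReal.toReal_ofReal (hp0 _ _), hg0]
  rw [hcalc]
  simp

/-! ### Likelihoods -/

section Likelihood

variable {N : ℕ} {Θ : Type*} {f : Fin N → ℝ → ℝ → Θ → ℝ}

theorem IsLikelihood.integrable (hf : IsLikelihood f) (i : Fin N) (x : ℝ) (θ : Θ) :
    Integrable fun y => f i y x θ :=
  integrable_of_integral_eq_one (hf.integral_eq_one i x θ)

/-- A likelihood that is continuous in the decision is jointly measurable. -/
theorem IsLikelihood.measurable_prod (hf : IsLikelihood f) (h1 : BoundedBelief f) (i : Fin N)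
    (θ : Θ) : Measurable fun z : ℝ × ℝ => f i z.2 z.1 θ :=
  measurable_uncurry_of_continuous_of_measurable (u := fun x y => f i y x θ)
    (fun y => h1.continuous i y θ) (fun x => hf.measurable i x θ)

theorem IsLikelihood.measurable_logRatio (hf : IsLikelihood f) (h1 : BoundedBelief f) (i : Fin N)
    (θ θ' : Θ) : Measurable fun z : ℝ × ℝ => Real.log (f i z.2 z.1 θ / f i z.2 z.1 θ') :=
  ((hf.measurable_prod h1 i θ).div (hf.measurable_prod h1 i θ')).log

theorem IsLikelihood.integrable_mul_log (hf : IsLikelihood f) (h1 : BoundedBelief f) (i : Fin N)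
    (x : ℝ) (θs θ : Θ) :
    Integrable fun y => f i y x θs * Real.log (f i y x θs / f i y x θ) := by
  obtain ⟨B, _, hB⟩ := h1.bounded
  exact (hf.integrable i x θs).mul_bdd
    ((hf.measurable_logRatio h1 i θs θ).comp measurable_prodMk_left).aestronglyMeasurable
    (.of_forall fun y => (hB i θs θ x y).le)

theorem IsLikelihood.abs_densityKL_le (hf : IsLikelihood f) {B : ℝ}
    (hB : ∀ i θ' θ'' x y, |Real.log (f i y x θ' / f i y x θ'')| < B) (i : Fin N)
    (x : ℝ) (θs θ : Θ) :
    |densityKL (fun y => f i y x θs) (fun y => f i y x θ)| ≤ B := by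
  have h := norm_integral_le_of_norm_le (μ := volume)
    (f := fun y => f i y x θs * Real.log (f i y x θs / f i y x θ))
    ((hf.integrable i x θs).mul_const B) (.of_forall fun y => by
      rw [Real.norm_eq_abs, abs_mul, abs_of_pos (hf.pos i y x θs)]
      exact mul_le_mul_of_nonneg_left (hB i θs θ x y).le (hf.pos i y x θs).le)
  rwa [integral_mul_const, hf.integral_eq_one, one_mul] at h

theorem IsLikelihood.measurable_densityKL (hf : IsLikelihood f) (h1 : BoundedBelief f) (i : Fin N)
    (θs θ : Θ) : Measurable fun x => densityKL (fun y => f i y x θs) (fun y => f i y x θ) := by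
  have : Measurable (Function.uncurry fun x y : ℝ =>
      f i y x θs * Real.log (f i y x θs / f i y x θ)) :=
    (hf.measurable_prod h1 i θs).mul (hf.measurable_logRatio h1 i θs θ)
  exact this.stronglyMeasurable.integral_prod_right.measurable

/-- The nonnegative integrand `g log (g / h) - g + h` has the same integral as the
Kullback-Leibler integrand. -/
theorem IsLikelihood.ofReal_densityKL (hf : IsLikelihood f) (h1 : BoundedBelief f) (i : Fin N)
    (x : ℝ) (θs θ : Θ) :
    0 ≤ densityKL (fun y => f i y x θs) (fun y => f i y x θ) ∧
    ENNReal.ofReal (densityKL (fun y => f i y x θs) (fun y => f i y x θ))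
      = ∫⁻ y, ENNReal.ofReal (f i y x θs * Real.log (f i y x θs / f i y x θ)
          - f i y x θs + f i y x θ) := by
  have hi := hf.integrable_mul_log h1 i x θs θ
  have hi0 : Integrable fun y =>
      f i y x θs * Real.log (f i y x θs / f i y x θ) - f i y x θs := hi.sub (hf.integrable i x θs)
  have hi' := hi0.add (hf.integrable i x θ)
  have heq : densityKL (fun y => f i y x θs) (fun y => f i y x θ)
      = ∫ y, (f i y x θs * Real.log (f i y x θs / f i y x θ) - f i y x θs + f i y x θ) := by
    rw [integral_add hi0 (hf.integrable i x θ),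
      integral_sub hi (hf.integrable i x θs), hf.integral_eq_one, hf.integral_eq_one]
    simp [densityKL]
  have hnn : ∀ y, 0 ≤ f i y x θs * Real.log (f i y x θs / f i y x θ) - f i y x θs + f i y x θ := by
    intro y
    have hg := hf.pos i y x θs
    have hh := hf.pos i y x θ
    have h2 := mul_le_mul_of_nonneg_left (Real.one_sub_inv_le_log_of_pos (div_pos hg hh)) hg.le
    rw [mul_sub, inv_div, mul_div_cancel₀ _ hg.ne'] at h2
    linarith
  rw [heq]
  exact ⟨integral_nonneg hnn, ofReal_integral_eq_lintegral_ofReal hi' (.of_forall hnn)⟩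

theorem IsLikelihood.densityKL_nonneg (hf : IsLikelihood f) (h1 : BoundedBelief f) (i : Fin N)
    (x : ℝ) (θs θ : Θ) : 0 ≤ densityKL (fun y => f i y x θs) (fun y => f i y x θ) :=
  (hf.ofReal_densityKL h1 i x θs θ).1

/-- A divergence that is positive at all decisions is bounded away from zero on bounded sets. -/
theorem IsLikelihood.exists_le_densityKL (hf : IsLikelihood f) (h1 : BoundedBelief f) (i : Fin N)
    (θs θ : Θ) (hpos : ∀ x, 0 < densityKL (fun y => f i y x θs) (fun y => f i y x θ)) (R : ℝ) :
    ∃ c, 0 < c ∧ ∀ x, |x| ≤ R → c ≤ densityKL (fun y => f i y x θs) (fun y => f i y x θ) := by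
  set k : ℝ → ℝ → ENNReal := fun x y => ENNReal.ofReal
    (f i y x θs * Real.log (f i y x θs / f i y x θ) - f i y x θs + f i y x θ) with hk
  have hkc : ∀ y, Continuous fun x => k x y := by
    intro y
    have c1 := h1.continuous i y θs
    have c2 := h1.continuous i y θ
    refine ENNReal.continuous_ofReal.comp (((c1.mul ?_).sub c1).add c2)
    exact (c1.div c2 fun x => (hf.pos i y x θ).ne').log
      fun x => (div_pos (hf.pos i y x θs) (hf.pos i y x θ)).ne'
  have hkm : ∀ x, Measurable (k x) := by
    intro x
    have m1 := hf.measurable i x θs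
    have m2 := hf.measurable i x θ
    exact (((m1.mul (m1.div m2).log).sub m1).add m2).ennreal_ofReal
  -- The integrand is nonnegative and continuous in `x`, so Fatou gives lower semicontinuity of the
  -- divergence, enough for a minimum on a compact interval.
  have hlsc : LowerSemicontinuous fun x => ∫⁻ y, k x y := by
    refine lowerSemicontinuous_iff_le_liminf.2 fun x => ?_
    refine le_trans (le_of_eq ?_) (lintegral_liminf_le hkm)
    exact lintegral_congr fun y => ((hkc y).tendsto x).liminf_eq.symm
  rcases (Set.Icc (-R) R).eq_empty_or_nonempty with hE | hE
  · refine ⟨1, one_pos, fun x hx => ?_⟩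
    have : x ∈ Set.Icc (-R) R := abs_le.1 hx
    simp [hE] at this
  · obtain ⟨x₀, _, hmin⟩ := (hlsc.lowerSemicontinuousOn _).exists_isMinOn hE isCompact_Icc
    refine ⟨_, hpos x₀, fun x hx => ?_⟩
    have h2 : ∫⁻ y, k x₀ y ≤ ∫⁻ y, k x y := hmin (abs_le.1 hx)
    rw [← (hf.ofReal_densityKL h1 i x₀ θs θ).2, ← (hf.ofReal_densityKL h1 i x θs θ).2] at h2
    exact (ENNReal.ofReal_le_ofReal_iff (hpos x).le).1 h2

end Likelihood

/-! ### Strongly monotone Lipschitz functions -/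

/-- `h` is strongly monotone with constant `m` and Lipschitz with constant `L`. -/
def StronglyMonotoneLipschitz (m L : ℝ) (h : ℝ → ℝ) : Prop :=
  ∀ x y, m * |x - y| ^ 2 ≤ (h x - h y) * (x - y) ∧ |h x - h y| ≤ L * |x - y|

namespace StronglyMonotoneLipschitz

variable {m L : ℝ} {h : ℝ → ℝ}

/-- Convex combinations keep both constants. This serves averages over beliefs and averages over
agents alike. -/
theorem sum_mul {ι : Type*} [Fintype ι] {h : ι → ℝ → ℝ} {w : ι → ℝ}
    (hh : ∀ k, StronglyMonotoneLipschitz m L (h k)) (hw0 : ∀ k, 0 ≤ w k) (hw1 : ∑ k, w k = 1) :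
    StronglyMonotoneLipschitz m L fun z => ∑ k, h k z * w k := by
  intro x y
  have hsub : ∑ k, h k x * w k - ∑ k, h k y * w k = ∑ k, (h k x - h k y) * w k := by
    simp only [sub_mul, Finset.sum_sub_distrib]
  rw [hsub]
  constructor
  · calc m * |x - y| ^ 2 = ∑ k, m * |x - y| ^ 2 * w k := by rw [← Finset.mul_sum, hw1, mul_one]
      _ ≤ ∑ k, (h k x - h k y) * (x - y) * w k :=
          Finset.sum_le_sum fun k _ => mul_le_mul_of_nonneg_right (hh k x y).1 (hw0 k)
      _ = _ := by
          rw [Finset.sum_mul]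
          exact Finset.sum_congr rfl fun k _ => by ring
  · calc |∑ k, (h k x - h k y) * w k| ≤ ∑ k, |(h k x - h k y) * w k| :=
          Finset.abs_sum_le_sum_abs _ _
      _ ≤ ∑ k, L * |x - y| * w k := Finset.sum_le_sum fun k _ => by
          rw [abs_mul, abs_of_nonneg (hw0 k)]
          exact mul_le_mul_of_nonneg_right (hh k x y).2 (hw0 k)
      _ = L * |x - y| := by rw [← Finset.mul_sum, hw1, mul_one]

theorem step (hh : StronglyMonotoneLipschitz m L h) {a : ℝ} (ha : 0 ≤ a) (haL : a * L ≤ 1)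
    (x y : ℝ) : |(x - a * h x) - (y - a * h y)| ≤ (1 - a * m) * |x - y| :=
  abs_gradient_step_sub_le ha haL (hh x y).1 (hh x y).2

protected theorem continuous (hh : StronglyMonotoneLipschitz m L h) : Continuous h := by
  refine (LipschitzWith.of_dist_le_mul (K := L.toNNReal) fun x y => ?_).continuous
  rw [Real.dist_eq, Real.dist_eq]
  exact (hh x y).2.trans (mul_le_mul_of_nonneg_right (Real.le_coe_toNNReal L) (abs_nonneg _))

theorem abs_le (hh : StronglyMonotoneLipschitz m L h) {x R : ℝ} (hx : |x| ≤ R) :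
    |h x| ≤ |h 0| + |L| * R := by
  have h1 := (hh x 0).2
  rw [sub_zero] at h1
  have h2 : L * |x| ≤ |L| * R :=
    mul_le_mul (le_abs_self L) hx (abs_nonneg x) (abs_nonneg L)
  have h3 : |h x| ≤ |h x - h 0| + |h 0| := by
    simpa using abs_add_le (h x - h 0) (h 0)
  linarith

theorem strictMono (hh : StronglyMonotoneLipschitz m L h) (hm : 0 < m) : StrictMono h := by
  intro x y hxy
  have h1 := (hh y x).1
  have h2 : 0 < m * |y - x| ^ 2 := mul_pos hm (pow_pos (abs_pos.2 (sub_pos.2 hxy).ne') 2)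
  have h3 := pos_of_mul_pos_left (h2.trans_le h1) (sub_pos.2 hxy).le
  linarith

/-- At distance `|h 0| / m` from the origin, strong monotonicity has compensated `h 0`, so `h` has
opposite weak signs at `±K`. -/
theorem exists_eq_zero (hh : StronglyMonotoneLipschitz m L h) (hm : 0 < m) : ∃ x, h x = 0 := by
  rcases (abs_nonneg (h 0)).eq_or_lt with h0 | h0
  · exact ⟨0, abs_eq_zero.1 h0.symm⟩
  set K := |h 0| / m with hK
  have hKpos : 0 < K := div_pos h0 hm
  have hmK : m * K = |h 0| := mul_div_cancel₀ _ hm.ne'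
  have h1 := (hh K 0).1
  have h2 := (hh (-K) 0).1
  simp only [sub_zero, abs_neg, abs_of_pos hKpos] at h1 h2
  have h3 : 0 ≤ h K := by
    have : |h 0| ≤ h K - h 0 := by rw [← hmK]; nlinarith
    linarith [neg_abs_le (h 0)]
  have h4 : h (-K) ≤ 0 := by
    have : |h 0| ≤ h 0 - h (-K) := by rw [← hmK]; nlinarith
    linarith [le_abs_self (h 0)]
  obtain ⟨x, _, hx⟩ := intermediate_value_Icc (by linarith : -K ≤ K) hh.continuous.continuousOn
    (⟨h4, h3⟩ : (0 : ℝ) ∈ Set.Icc (h (-K)) (h K))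
  exact ⟨x, hx⟩

/-- A zero of a strongly monotone derivative is the unique global minimizer. -/
theorem isMin_of_deriv (hh : StronglyMonotoneLipschitz m L h) (hm : 0 < m) {F : ℝ → ℝ}
    (hF : ∀ x, HasDerivAt F (h x) x) {xs : ℝ} (hxs : h xs = 0) :
    (∀ x, F xs ≤ F x) ∧ ∀ x', (∀ x, F x' ≤ F x) → x' = xs := by
  have hFd : Differentiable ℝ F := fun x => (hF x).differentiableAt
  have hmono := hh.strictMono hm
  refine ⟨fun x => ?_, fun x' hx' => ?_⟩
  · rcases le_total xs x with hle | hle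
    · refine monotoneOn_of_deriv_nonneg (convex_Ici xs) hFd.continuous.continuousOn
        hFd.differentiableOn (fun z hz => ?_) Set.self_mem_Ici hle hle
      rw [interior_Ici] at hz
      rw [(hF z).deriv, ← hxs]
      exact hmono.monotone (le_of_lt hz)
    · refine antitoneOn_of_deriv_nonpos (convex_Iic xs) hFd.continuous.continuousOn
        hFd.differentiableOn (fun z hz => ?_) hle Set.self_mem_Iic hle
      rw [interior_Iic] at hz
      rw [(hF z).deriv, ← hxs]
      exact hmono.monotone (le_of_lt hz)
  · have hmin : IsLocalMin F x' := .of_forall hx'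
    exact hmono.injective ((hmin.hasDerivAt_eq_zero (hF x')).trans hxs.symm)

end StronglyMonotoneLipschitz

theorem CostAssumption.stronglyMonotoneLipschitz {N : ℕ} {Θ : Type*} {J : Fin N → ℝ → Θ → ℝ}
    {m L : ℝ} (h4 : CostAssumption J m L) (i : Fin N) (θ : Θ) :
    StronglyMonotoneLipschitz m L (deriv fun z => J i z θ) :=
  fun x y => ⟨h4.strongly_convex i θ y x, h4.smooth i θ y x⟩

theorem CostAssumption.stronglyMonotoneLipschitz_average {N : ℕ} {Θ : Type*}
    {J : Fin N → ℝ → Θ → ℝ} {m L : ℝ} (h4 : CostAssumption J m L) (hN : 0 < N) (θ : Θ) :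
    StronglyMonotoneLipschitz m L fun z => ∑ i, deriv (fun z => J i z θ) z * (1 / (N : ℝ)) := by
  refine .sum_mul (fun i => h4.stronglyMonotoneLipschitz i θ) (fun _ => by positivity) ?_
  have : (N : ℝ) ≠ 0 := Nat.cast_ne_zero.2 hN.ne'
  simp [this]

theorem CostAssumption.hasDerivAt_globalCost {N : ℕ} {Θ : Type*} {J : Fin N → ℝ → Θ → ℝ}
    {m L : ℝ} (h4 : CostAssumption J m L) (θ : Θ) (x : ℝ) :
    HasDerivAt (globalCost J θ) (∑ i, deriv (fun z => J i z θ) x * (1 / (N : ℝ))) x := by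
  have h := (HasDerivAt.fun_sum (u := Finset.univ) fun i _ =>
    (h4.differentiable i θ x).hasDerivAt).const_mul (1 / (N : ℝ))
  rw [Finset.mul_sum] at h
  rw [Finset.sum_congr rfl fun i _ => mul_comm (deriv (fun z => J i z θ) x) (1 / (N : ℝ))]
  exact h

theorem CostAssumption.deriv_expectedCost {N : ℕ} {Θ : Type*} [Fintype Θ]
    {J : Fin N → ℝ → Θ → ℝ} {m L : ℝ} (h4 : CostAssumption J m L) (q : Fin N → Θ → ℝ) (i : Fin N)
    (x : ℝ) : deriv (expectedCost J q i) x = ∑ θ, deriv (fun z => J i z θ) x * q i θ :=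
  (HasDerivAt.fun_sum (u := Finset.univ) fun θ _ =>
    (h4.differentiable i θ x).hasDerivAt.mul_const (q i θ)).deriv

theorem StepsizePolicy.tendsto_zero {α : ℕ → ℝ} (h3 : StepsizePolicy α) :
    Tendsto α atTop (𝓝 0) := by
  have h := h3.sum_sq.tendsto_atTop_zero.sqrt
  simpa [Real.sqrt_sq (h3.pos _).le] using h

theorem StepsizePolicy.eventually_mul_le_one {α : ℕ → ℝ} (h3 : StepsizePolicy α) (c : ℝ) :
    ∀ᶠ t in atTop, α t * c ≤ 1 := by
  have h := h3.tendsto_zero.mul_const c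
  rw [zero_mul] at h
  exact h.eventually_le_const one_pos

/-! ### Beliefs -/

section Beliefs

variable {N : ℕ} {Θ : Type*} [Fintype Θ] {J : Fin N → ℝ → Θ → ℝ}
  {f : Fin N → ℝ → ℝ → Θ → ℝ} {θs : Θ} {G : SimpleGraph (Fin N)}
  {W : Matrix (Fin N) (Fin N) ℝ} {α : ℕ → ℝ} {m L : ℝ}
  {x₀ y₀ : Fin N → ℝ} {ε : ℕ → Fin N → ℝ}

theorem log_fractionalPosterior_sub (hf : IsLikelihood f) (a : ℝ) {s : AgentState N Θ}
    (hs : ∀ i θ, 0 < s.q i θ) (i : Fin N) (θ θ' : Θ) :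
    Real.log (fractionalPosterior f a s i θ) - Real.log (fractionalPosterior f a s i θ')
      = Real.log (s.q i θ) - Real.log (s.q i θ')
        + a * Real.log (f i (s.y i) (s.x i) θ / f i (s.y i) (s.x i) θ') := by
  have hp : ∀ θ', 0 < f i (s.y i) (s.x i) θ' ^ a := fun θ' =>
    Real.rpow_pos_of_pos (hf.pos _ _ _ _) a
  have h : ∀ θ', 0 < f i (s.y i) (s.x i) θ' ^ a * s.q i θ' := fun θ' =>
    mul_pos (hp θ') (hs i θ')
  have hsum : 0 < ∑ θ', f i (s.y i) (s.x i) θ' ^ a * s.q i θ' :=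
    Finset.sum_pos (fun θ' _ => h θ') ⟨θ, Finset.mem_univ _⟩
  simp only [fractionalPosterior]
  rw [Real.log_div (h θ).ne' hsum.ne', Real.log_div (h θ').ne' hsum.ne',
    Real.log_mul (hp θ).ne' (hs i θ).ne', Real.log_mul (hp θ').ne' (hs i θ').ne',
    Real.log_rpow (hf.pos _ _ _ _), Real.log_rpow (hf.pos _ _ _ _),
    Real.log_div (hf.pos _ _ _ _).ne' (hf.pos _ _ _ _).ne']
  ring

theorem sum_exp_pos (θ : Θ) (g : Θ → ℝ) : 0 < ∑ θ', Real.exp (g θ') :=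
  Finset.sum_pos (fun _ _ => Real.exp_pos _) ⟨θ, Finset.mem_univ _⟩

theorem logBeliefConsensus_pos (b : Fin N → Θ → ℝ) (i : Fin N) (θ : Θ) :
    0 < logBeliefConsensus W b i θ :=
  div_pos (Real.exp_pos _) (sum_exp_pos θ _)

theorem sum_logBeliefConsensus (θ : Θ) (b : Fin N → Θ → ℝ) (i : Fin N) :
    ∑ θ', logBeliefConsensus W b i θ' = 1 := by
  simp only [logBeliefConsensus, ← Finset.sum_div]
  exact div_self (sum_exp_pos θ _).ne'

theorem log_logBeliefConsensus_sub (b : Fin N → Θ → ℝ) (i : Fin N) (θ θ' : Θ) :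
    Real.log (logBeliefConsensus W b i θ) - Real.log (logBeliefConsensus W b i θ')
      = ∑ j, W i j * (Real.log (b j θ) - Real.log (b j θ')) := by
  simp only [logBeliefConsensus]
  rw [Real.log_div (Real.exp_pos _).ne' (sum_exp_pos θ _).ne',
    Real.log_div (Real.exp_pos _).ne' (sum_exp_pos θ _).ne', Real.log_exp, Real.log_exp]
  simp only [mul_sub, Finset.sum_sub_distrib]
  ring

theorem algorithmRun_q_pos (t : ℕ) (i : Fin N) (θ : Θ) :
    0 < (algorithmRun J f θs W α x₀ y₀ ε t).q i θ := by
  cases t with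
  | zero =>
    have : Nonempty Θ := ⟨θ⟩
    exact one_div_pos.2 (Nat.cast_pos.2 Fintype.card_pos)
  | succ t => exact logBeliefConsensus_pos _ i θ

theorem sum_algorithmRun_q (t : ℕ) (i : Fin N) :
    ∑ θ, (algorithmRun J f θs W α x₀ y₀ ε t).q i θ = 1 := by
  cases t with
  | zero =>
    have : Nonempty Θ := ⟨θs⟩
    simp [algorithmRun]
  | succ t => exact sum_logBeliefConsensus θs _ i

/-- In log-ratios both normalizing sums cancel: the Bayesian update is additive and the consensus
step is linear. -/
theorem algorithmRun_log_q_sub_succ (hf : IsLikelihood f) (t : ℕ) (i : Fin N) (θ θ' : Θ) :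
    Real.log ((algorithmRun J f θs W α x₀ y₀ ε (t + 1)).q i θ)
        - Real.log ((algorithmRun J f θs W α x₀ y₀ ε (t + 1)).q i θ')
      = ∑ j, W i j * (Real.log ((algorithmRun J f θs W α x₀ y₀ ε t).q j θ)
          - Real.log ((algorithmRun J f θs W α x₀ y₀ ε t).q j θ')
          + α t * Real.log (f j ((algorithmRun J f θs W α x₀ y₀ ε t).y j)
              ((algorithmRun J f θs W α x₀ y₀ ε t).x j) θ
            / f j ((algorithmRun J f θs W α x₀ y₀ ε t).y j)
              ((algorithmRun J f θs W α x₀ y₀ ε t).x j) θ')) := by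
  refine (log_logBeliefConsensus_sub _ i θ θ').trans (Finset.sum_congr rfl fun j _ => ?_)
  rw [log_fractionalPosterior_sub hf _ (algorithmRun_q_pos t)]

theorem algorithmRun_x_succ (h4 : CostAssumption J m L) (t : ℕ) (i : Fin N) :
    (algorithmRun J f θs W α x₀ y₀ ε (t + 1)).x i
      = ∑ j, W i j * ((algorithmRun J f θs W α x₀ y₀ ε t).x j
          - α t * ∑ θ, deriv (fun z => J j z θ) ((algorithmRun J f θs W α x₀ y₀ ε t).x j)
            * (algorithmRun J f θs W α x₀ y₀ ε (t + 1)).q j θ) := by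
  refine (rfl : _ = decisionUpdate J W (α t) _
    (algorithmRun J f θs W α x₀ y₀ ε (t + 1)).q i).trans ?_
  simp only [decisionUpdate, h4.deriv_expectedCost]

/-- The decisions remain bounded. -/
theorem exists_abs_algorithmRun_x_le (h2 : NetworkAssumption G W) (h3 : StepsizePolicy α)
    (h4 : CostAssumption J m L) :
    ∃ R, ∀ t i, |(algorithmRun J f θs W α x₀ y₀ ε t).x i| ≤ R := by
  set S := algorithmRun J f θs W α x₀ y₀ ε with hS
  set C : ℝ := ∑ i, ∑ θ, |deriv (fun z => J i z θ) 0| with hC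
  have hC0 : 0 ≤ C := Finset.sum_nonneg fun _ _ => Finset.sum_nonneg fun _ _ => abs_nonneg _
  have hCle : ∀ i θ, |deriv (fun z => J i z θ) 0| ≤ C := fun i θ =>
    (Finset.single_le_sum (f := fun θ => |deriv (fun z => J i z θ) 0|)
      (fun _ _ => abs_nonneg _) (Finset.mem_univ θ)).trans
    (Finset.single_le_sum (f := fun i => ∑ θ, |deriv (fun z => J i z θ) 0|)
      (fun _ _ => Finset.sum_nonneg fun _ _ => abs_nonneg _) (Finset.mem_univ i))
  have hev : ∀ᶠ t in atTop, α t * L ≤ 1 ∧ α t * m ≤ 1 :=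
    (h3.eventually_mul_le_one L).and (h3.eventually_mul_le_one m)
  obtain ⟨T, hT⟩ := eventually_atTop.1 hev
  -- The sum covers the iterations up to `T`. The term `C / m` gives `C ≤ m * R`, so that `(1 - α t
  -- * m) * R + α t * C ≤ R` and `[-R, R]` is invariant from `T` on.
  set R : ℝ := (∑ t ∈ Finset.range (T + 1), ∑ i, |(S t).x i|) + C / m with hR
  have hinit : ∀ t ≤ T, ∀ i, |(S t).x i| ≤ R := by
    intro t ht i
    have h1 := Finset.single_le_sum (f := fun i => |(S t).x i|)
      (fun _ _ => abs_nonneg _) (Finset.mem_univ i)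
    have h2 := Finset.single_le_sum (f := fun t => ∑ i, |(S t).x i|)
      (fun _ _ => Finset.sum_nonneg fun _ _ => abs_nonneg _)
      (Finset.mem_range.2 (Nat.lt_succ_of_le ht))
    have h3 := div_nonneg hC0 h4.pos.le
    linarith
  have hRC : C ≤ m * R := by
    have h1 : 0 ≤ ∑ t ∈ Finset.range (T + 1), ∑ i, |(S t).x i| :=
      Finset.sum_nonneg fun _ _ => Finset.sum_nonneg fun _ _ => abs_nonneg _
    have h2 : m * (C / m) = C := mul_div_cancel₀ _ h4.pos.ne'
    nlinarith [mul_nonneg h4.pos.le h1]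
  have hlate : ∀ t, T ≤ t → ∀ i, |(S t).x i| ≤ R := by
    intro t ht
    induction t, ht using Nat.le_induction with
    | base => exact hinit T le_rfl
    | succ t ht ih =>
      intro i
      have hstep : ∀ j, |(S t).x j - α t * ∑ θ, deriv (fun z => J j z θ) ((S t).x j)
          * (S (t + 1)).q j θ| ≤ R := by
        intro j
        have hq0 : ∀ θ, 0 ≤ (S (t + 1)).q j θ := fun θ => (algorithmRun_q_pos _ _ _).le
        have hq1 : ∑ θ, (S (t + 1)).q j θ = 1 := sum_algorithmRun_q _ _
        have hs := (StronglyMonotoneLipschitz.sum_mul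
          (fun θ => h4.stronglyMonotoneLipschitz j θ) hq0 hq1).step (h3.pos t).le (hT t ht).1
          ((S t).x j) 0
        have hg0 : |∑ θ, deriv (fun z => J j z θ) 0 * (S (t + 1)).q j θ| ≤ C := by
          calc _ ≤ ∑ θ, |deriv (fun z => J j z θ) 0 * (S (t + 1)).q j θ| :=
                Finset.abs_sum_le_sum_abs _ _
            _ ≤ ∑ θ, C * (S (t + 1)).q j θ := Finset.sum_le_sum fun θ _ => by
                rw [abs_mul, abs_of_nonneg (hq0 θ)]
                exact mul_le_mul_of_nonneg_right (hCle j θ) (hq0 θ)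
            _ = C := by rw [← Finset.mul_sum, hq1, mul_one]
        set g := ∑ θ, deriv (fun z => J j z θ) ((S t).x j) * (S (t + 1)).q j θ
        set g₀ := ∑ θ, deriv (fun z => J j z θ) 0 * (S (t + 1)).q j θ
        have hα := h3.pos t
        have h5 : |(S t).x j - α t * g|
            ≤ |(S t).x j - α t * g - (0 - α t * g₀)| + α t * |g₀| := by
          have := abs_add_le ((S t).x j - α t * g - (0 - α t * g₀)) (-(α t * g₀))
          rw [abs_neg, abs_mul, abs_of_pos hα] at this
          refine le_trans (le_of_eq ?_) this
          congr 1
          ring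
        rw [sub_zero] at hs
        have h6 := mul_le_mul_of_nonneg_left (ih j) (sub_nonneg.2 (hT t ht).2)
        have h7 := mul_le_mul_of_nonneg_left (hg0.trans hRC) hα.le
        linarith
      rw [hS, algorithmRun_x_succ h4, ← hS]
      refine (Finset.abs_sum_le_sum_abs _ _).trans ?_
      calc _ ≤ ∑ j, W i j * R := Finset.sum_le_sum fun j _ => by
            rw [abs_mul, abs_of_nonneg (h2.nonneg i j)]
            exact mul_le_mul_of_nonneg_left (hstep j) (h2.nonneg i j)
        _ = R := by rw [← Finset.sum_mul, h2.sum_row, one_mul]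
  exact ⟨R, fun t i => (le_total t T).elim (fun h => hinit t h i) fun h => hlate t h i⟩

/-- On a path where the centred log-likelihood ratios have convergent weighted sums, the beliefs
in a wrong parameter vanish. -/
theorem tendsto_algorithmRun_q_zero (hf : IsLikelihood f) (h1 : BoundedBelief f)
    (h2 : NetworkAssumption G W) (h3 : StepsizePolicy α) (h4 : CostAssumption J m L)
    (h5 : IdentifiableParameter f θs) {θ : Θ} (hθ : θ ≠ θs)
    (hconv : ∀ j, ∃ l, Tendsto (fun n => ∑ t ∈ Finset.range n, α t *
      (Real.log (f j ((algorithmRun J f θs W α x₀ y₀ ε t).y j)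
            ((algorithmRun J f θs W α x₀ y₀ ε t).x j) θ
          / f j ((algorithmRun J f θs W α x₀ y₀ ε t).y j)
            ((algorithmRun J f θs W α x₀ y₀ ε t).x j) θs)
        + densityKL (fun y => f j y ((algorithmRun J f θs W α x₀ y₀ ε t).x j) θs)
            (fun y => f j y ((algorithmRun J f θs W α x₀ y₀ ε t).x j) θ))) atTop (𝓝 l))
    (i : Fin N) :
    Tendsto (fun t => (algorithmRun J f θs W α x₀ y₀ ε t).q i θ) atTop (𝓝 0) := by
  obtain ⟨B, hB0, hB⟩ := h1.bounded
  obtain ⟨R, hR⟩ := exists_abs_algorithmRun_x_le (f := f) (θs := θs) (x₀ := x₀) (y₀ := y₀) (ε := ε)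
    h2 h3 h4
  obtain ⟨k, hk⟩ := h5 θ hθ
  obtain ⟨c, hc0, hc⟩ := hf.exists_le_densityKL h1 k θs θ hk R
  choose l hl using hconv
  set S := algorithmRun J f θs W α x₀ y₀ ε with hS
  set ℓ : ℕ → Fin N → ℝ := fun t j =>
    Real.log (f j ((S t).y j) ((S t).x j) θ / f j ((S t).y j) ((S t).x j) θs) with hℓ
  set D : ℕ → Fin N → ℝ := fun t j =>
    densityKL (fun y => f j y ((S t).x j) θs) (fun y => f j y ((S t).x j) θ) with hD
  set Λ : ℕ → Fin N → ℝ := fun t j => Real.log ((S t).q j θ) - Real.log ((S t).q j θs) with hΛ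
  have hrec : ∀ t i, Λ (t + 1) i = ∑ j, W i j * (Λ t j + α t * ℓ t j) := fun t i =>
    algorithmRun_log_q_sub_succ hf t i θ θs
  have hcons := h2.tendsto_sub_average (v := fun t j => α t * ℓ t j) hrec (fun j => by
    refine squeeze_zero_norm (a := fun t => α t * B) (fun t => ?_) (by
      simpa using h3.tendsto_zero.mul_const B)
    rw [norm_mul, Real.norm_eq_abs, Real.norm_eq_abs, abs_of_pos (h3.pos t)]
    exact mul_le_mul_of_nonneg_left (hB _ _ _ _ _).le (h3.pos t).le) i
  -- Uniform priors make the initial log-ratios zero.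
  have hsum : ∀ T, ∑ j, Λ T j = ∑ t ∈ Finset.range T, α t * ∑ j, ℓ t j := by
    intro T
    induction T with
    | zero => simp [hΛ, hS, algorithmRun]
    | succ T ih =>
      simp only [hrec, sum_mul_sum_of_mem_doublyStochastic h2.doublyStochastic,
        Finset.sum_add_distrib]
      rw [ih, Finset.sum_range_succ, Finset.mul_sum]
  -- Write `ℓ = (ℓ + D) - D`. Of the nonnegative divergences only that of the identifying agent `k`
  -- is kept, bounded below by `c`.
  have hle : ∀ T, ∑ j, Λ T j ≤ ∑ j, ∑ t ∈ Finset.range T, α t * (ℓ t j + D t j)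
      + -(c * ∑ t ∈ Finset.range T, α t) := by
    intro T
    rw [hsum, Finset.sum_comm, Finset.mul_sum, ← Finset.sum_neg_distrib, ← Finset.sum_add_distrib]
    refine Finset.sum_le_sum fun t _ => ?_
    rw [← Finset.mul_sum, Finset.sum_add_distrib]
    have h6 : c ≤ ∑ j, D t j := (hc _ (hR t k)).trans
      (Finset.single_le_sum (f := fun j => D t j)
        (fun j _ => hf.densityKL_nonneg h1 j _ θs θ) (Finset.mem_univ k))
    have h7 := mul_le_mul_of_nonneg_left h6 (h3.pos t).le
    linarith
  have hbot : Tendsto (fun T => ∑ j, Λ T j) atTop atBot := by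
    refine tendsto_atBot_mono hle (Tendsto.add_atBot (tendsto_finsetSum _ fun j _ => hl j) ?_)
    exact tendsto_neg_atTop_atBot.comp (h3.sum_eq_top.const_mul_atTop hc0)
  have hN : (0 : ℝ) < N := Nat.cast_pos.2 (Fin.pos i)
  have hΛi : Tendsto (fun T => Λ T i) atTop atBot := by
    have := hcons.add_atBot (hbot.atBot_div_const hN)
    simpa using this
  -- Since `q i θs ≤ 1`, the belief in `θ` is at most the ratio `exp (Λ t i)`.
  refine squeeze_zero (fun t => (algorithmRun_q_pos t i θ).le) (fun t => ?_)
    (Real.tendsto_exp_atBot.comp hΛi)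
  have hqs : (S t).q i θs ≤ 1 := by
    rw [← sum_algorithmRun_q (J := J) (f := f) (θs := θs) (W := W) (α := α) (x₀ := x₀) (y₀ := y₀)
      (ε := ε) t i]
    exact Finset.single_le_sum (f := fun θ => (S t).q i θ)
      (fun θ _ => (algorithmRun_q_pos t i θ).le) (Finset.mem_univ θs)
  have hq := algorithmRun_q_pos (J := J) (f := f) (θs := θs) (W := W) (α := α) (x₀ := x₀)
    (y₀ := y₀) (ε := ε) t i
  simp only [Function.comp_apply, hΛ, Real.exp_sub]
  rw [Real.exp_log (hq θ), Real.exp_log (hq θs), le_div_iff₀ (hq θs)]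
  exact mul_le_of_le_one_right (hq θ).le hqs

/-- On a path where the beliefs in wrong parameters vanish, the decisions converge. -/
theorem tendsto_algorithmRun_x (h2 : NetworkAssumption G W) (h3 : StepsizePolicy α)
    (h4 : CostAssumption J m L) {xs : ℝ}
    (hxs : ∑ j, deriv (fun z => J j z θs) xs * (1 / (N : ℝ)) = 0)
    (hq : ∀ θ, θ ≠ θs → ∀ j,
      Tendsto (fun t => (algorithmRun J f θs W α x₀ y₀ ε t).q j θ) atTop (𝓝 0)) (i : Fin N) :
    Tendsto (fun t => (algorithmRun J f θs W α x₀ y₀ ε t).x i) atTop (𝓝 xs) := by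
  classical
  obtain ⟨R, hR⟩ := exists_abs_algorithmRun_x_le (f := f) (θs := θs) (x₀ := x₀) (y₀ := y₀) (ε := ε)
    h2 h3 h4
  have hqs : ∀ θ j, Tendsto (fun t => (algorithmRun J f θs W α x₀ y₀ ε t).q j θ
      - if θ = θs then 1 else 0) atTop (𝓝 0) := by
    intro θ j
    by_cases hθ : θ = θs
    · subst hθ
      have : ∀ t, (algorithmRun J f θ W α x₀ y₀ ε t).q j θ - (if θ = θ then 1 else 0)
          = -∑ θ' ∈ Finset.univ.erase θ, (algorithmRun J f θ W α x₀ y₀ ε t).q j θ' := by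
        intro t
        have h := sum_algorithmRun_q (J := J) (f := f) (θs := θ) (W := W) (α := α) (x₀ := x₀)
          (y₀ := y₀) (ε := ε) t j
        rw [← Finset.add_sum_erase _ _ (Finset.mem_univ θ)] at h
        simp only [if_true]
        linarith
      refine Tendsto.congr (fun t => (this t).symm) ?_
      have h := tendsto_finsetSum (Finset.univ.erase θ) fun θ' hθ' =>
        hq θ' (Finset.ne_of_mem_erase hθ') j
      simpa only [Finset.sum_const_zero, neg_zero] using h.neg
    · simpa [hθ] using hq θ hθ j
  set S := algorithmRun J f θs W α x₀ y₀ ε with hS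
  have hN : (N : ℝ) ≠ 0 := Nat.cast_ne_zero.2 (Fin.pos i).ne'
  set h : Fin N → Θ → ℝ → ℝ := fun j θ => deriv fun z => J j z θ with hh
  have hmon : ∀ j θ, StronglyMonotoneLipschitz m L (h j θ) := h4.stronglyMonotoneLipschitz
  set g : ℕ → Fin N → ℝ := fun t j => ∑ θ, h j θ ((S t).x j) * (S (t + 1)).q j θ with hg
  -- the belief-averaged gradients approach the true ones
  have hgt : ∀ j, Tendsto (fun t => g t j - h j θs ((S t).x j)) atTop (𝓝 0) := by
    intro j
    have heq : ∀ t, g t j - h j θs ((S t).x j)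
        = ∑ θ, h j θ ((S t).x j) * ((S (t + 1)).q j θ - if θ = θs then 1 else 0) := by
      intro t
      simp [hg, mul_sub, Finset.sum_sub_distrib]
    simp only [heq]
    refine (tendsto_finsetSum Finset.univ (a := fun _ => (0 : ℝ)) fun θ _ => ?_).mono_right
      (le_of_eq (by simp))
    refine squeeze_zero_norm (a := fun t => (|h j θ 0| + |L| * R) *
      |(S (t + 1)).q j θ - if θ = θs then 1 else 0|) (fun t => ?_) ?_
    · rw [norm_mul]
      exact mul_le_mul_of_nonneg_right ((hmon j θ).abs_le (hR t j)) (norm_nonneg _)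
    · have := (((tendsto_add_atTop_iff_nat 1).2 (hqs θ j)).abs).const_mul (|h j θ 0| + |L| * R)
      simpa using this
  have hαg : ∀ j, Tendsto (fun t => -(α t * g t j)) atTop (𝓝 0) := by
    intro j
    have h1 : Tendsto (fun t => α t * (g t j - h j θs ((S t).x j))) atTop (𝓝 0) := by
      simpa using h3.tendsto_zero.mul (hgt j)
    have h2 : Tendsto (fun t => α t * h j θs ((S t).x j)) atTop (𝓝 0) := by
      refine squeeze_zero_norm (a := fun t => α t * (|h j θs 0| + |L| * R)) (fun t => ?_) (by
        simpa using h3.tendsto_zero.mul_const (|h j θs 0| + |L| * R))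
      rw [norm_mul, Real.norm_eq_abs, Real.norm_eq_abs, abs_of_pos (h3.pos t)]
      exact mul_le_mul_of_nonneg_left ((hmon j θs).abs_le (hR t j)) (h3.pos t).le
    have h5 := (h1.add h2).neg
    simp only [add_zero, neg_zero] at h5
    exact h5.congr fun t => by ring
  have hrec : ∀ t i, (S (t + 1)).x i = ∑ j, W i j * ((S t).x j + -(α t * g t j)) := by
    intro t i
    simp only [← sub_eq_add_neg]
    exact algorithmRun_x_succ h4 t i
  have hcons := h2.tendsto_sub_average (z := fun t => (S t).x) hrec hαg
  set xb : ℕ → ℝ := fun t => (∑ j, (S t).x j) / N with hxb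
  set H : ℝ → ℝ := fun z => ∑ j, h j θs z * (1 / (N : ℝ)) with hH
  have hHmon : StronglyMonotoneLipschitz m L H :=
    h4.stronglyMonotoneLipschitz_average (Fin.pos i) θs
  have hHxs : H xs = 0 := hxs
  have hxbrec : ∀ t, xb (t + 1) = xb t - α t * ∑ j, g t j * (1 / (N : ℝ)) := by
    intro t
    simp only [hxb, hrec, sum_mul_sum_of_mem_doublyStochastic h2.doublyStochastic,
      Finset.sum_add_distrib, Finset.sum_neg_distrib, ← Finset.mul_sum, ← Finset.sum_mul]
    ring
  -- The gradient error combines disagreement (gradients taken at `x j`, not at the mean) with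
  -- residual belief in wrong parameters; both vanish.
  set E : ℕ → ℝ := fun t => |H (xb t) - ∑ j, g t j * (1 / (N : ℝ))| with hE
  have hE0 : Tendsto E atTop (𝓝 0) := by
    have hj : ∀ j, Tendsto (fun t => (h j θs (xb t) - g t j) * (1 / (N : ℝ))) atTop (𝓝 0) := by
      intro j
      have h6 : Tendsto (fun t => h j θs ((S t).x j) - h j θs (xb t)) atTop (𝓝 0) := by
        refine squeeze_zero_norm (fun t => (hmon j θs _ _).2) ?_
        simpa using (hcons j).abs.const_mul L
      have h7 := ((h6.add (hgt j)).neg).mul_const (1 / (N : ℝ))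
      simp only [add_zero, neg_zero, zero_mul] at h7
      exact h7.congr fun t => by ring
    have h8 := (tendsto_finsetSum Finset.univ fun j _ => hj j).abs
    simp only [Finset.sum_const_zero, abs_zero] at h8
    refine h8.congr fun t => ?_
    simp only [hE, hH, sub_mul, Finset.sum_sub_distrib]
  have hxblim : Tendsto (fun t => |xb t - xs|) atTop (𝓝 0) := by
    -- An exact step contracts by `1 - α t * m`, and the remainder `α t * E t` is rewritten as `γ t
    -- * (E t / m)`.
    refine tendsto_zero_of_le_convex_combination (γ := fun t => α t * m) (e := fun t => E t / m)
      (fun _ => abs_nonneg _) ?_ ?_ (fun t => (mul_pos (h3.pos t) h4.pos).le)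
      (by simpa using hE0.div_const m) ?_
    · exact h3.eventually_mul_le_one m
    · simp only [← Finset.sum_mul]
      exact h3.sum_eq_top.atTop_mul_const h4.pos
    · filter_upwards [h3.eventually_mul_le_one L] with t ht
      have h9 := hHmon.step (h3.pos t).le ht (xb t) xs
      rw [hHxs, mul_zero, sub_zero] at h9
      have h10 : α t * m * (E t / m) = |α t * (H (xb t) - ∑ j, g t j * (1 / (N : ℝ)))| := by
        rw [abs_mul, abs_of_pos (h3.pos t), mul_assoc, mul_div_cancel₀ _ h4.pos.ne']
      rw [h10, hxbrec]
      have h11 := abs_add_le (xb t - α t * H (xb t) - xs)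
        (α t * (H (xb t) - ∑ j, g t j * (1 / (N : ℝ))))
      have h12 : xb t - α t * ∑ j, g t j * (1 / (N : ℝ)) - xs
          = xb t - α t * H (xb t) - xs + α t * (H (xb t) - ∑ j, g t j * (1 / (N : ℝ))) := by
        ring
      rw [h12]
      linarith
  have h13 : Tendsto (fun t => xb t - xs) atTop (𝓝 0) :=
    (tendsto_zero_iff_abs_tendsto_zero _).2 hxblim
  have h14 := ((hcons i).add h13).add_const xs
  simp only [add_zero, zero_add] at h14
  exact h14.congr fun t => by simp only [hxb]; ring

end Beliefs

/-! ### The random run -/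

section History

variable {N : ℕ} {Θ Ω : Type*}

theorem historyBefore_mono (S : ℕ → Ω → AgentState N Θ) : Monotone (historyBefore S) :=
  fun _ _ hst => sup_le_sup
    (iSup₂_le fun r hr => le_iSup₂ (f := fun (s : ℕ) (_ : s ≤ _) =>
      MeasurableSpace.comap (fun ω => (S s ω).x) inferInstance) r (hr.trans hst))
    (iSup₂_le fun r hr => le_iSup₂ (f := fun (s : ℕ) (_ : s < _) =>
      MeasurableSpace.comap (fun ω => (S s ω).y) inferInstance) r (hr.trans_le hst))

theorem historyBefore_le [MeasurableSpace Ω] {S : ℕ → Ω → AgentState N Θ} (hx : ∀ t, Measurable fun ω => (S t ω).x)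
    (hy : ∀ t, Measurable fun ω => (S t ω).y) (t : ℕ) : historyBefore S t ≤ ‹MeasurableSpace Ω› :=
  sup_le (iSup₂_le fun s _ => (hx s).comap_le) (iSup₂_le fun s _ => (hy s).comap_le)

theorem measurable_x_historyBefore (S : ℕ → Ω → AgentState N Θ) (t : ℕ) (i : Fin N) :
    Measurable[historyBefore S t] fun ω => (S t ω).x i :=
  ((measurable_pi_apply i).comp (comap_measurable fun ω => (S t ω).x)).mono
    ((le_iSup₂ (f := fun (s : ℕ) (_ : s ≤ t) =>
      MeasurableSpace.comap (fun ω => (S s ω).x) inferInstance) t le_rfl).trans le_sup_left) le_rfl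

theorem measurable_y_historyBefore (S : ℕ → Ω → AgentState N Θ) (t : ℕ) (i : Fin N) :
    Measurable[historyBefore S (t + 1)] fun ω => (S t ω).y i :=
  ((measurable_pi_apply i).comp (comap_measurable fun ω => (S t ω).y)).mono
    ((le_iSup₂ (f := fun (s : ℕ) (_ : s < t + 1) =>
      MeasurableSpace.comap (fun ω => (S s ω).y) inferInstance) t t.lt_succ_self).trans
      le_sup_right) le_rfl

end History

section RandomRun

variable {N : ℕ} {Θ : Type*} {J : Fin N → ℝ → Θ → ℝ}
  {f : Fin N → ℝ → ℝ → Θ → ℝ} {θs : Θ} {W : Matrix (Fin N) (Fin N) ℝ} {α : ℕ → ℝ} {m L : ℝ}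
  {Ω : Type*} [MeasurableSpace Ω] {x₀ y₀ : Ω → Fin N → ℝ} {ε : ℕ → Ω → Fin N → ℝ}

theorem measurable_algorithmRun [Fintype Θ] (hx₀ : Measurable x₀) (hy₀ : Measurable y₀)
    (hε : ∀ t, Measurable (ε t)) (hf : IsLikelihood f) (h1 : BoundedBelief f)
    (h4 : CostAssumption J m L) (t : ℕ) :
    (Measurable fun ω => (algorithmRun J f θs W α (x₀ ω) (y₀ ω) (fun s => ε s ω) t).x) ∧
    (Measurable fun ω => (algorithmRun J f θs W α (x₀ ω) (y₀ ω) (fun s => ε s ω) t).y) ∧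
    ∀ i θ, Measurable fun ω =>
      (algorithmRun J f θs W α (x₀ ω) (y₀ ω) (fun s => ε s ω) t).q i θ := by
  induction t with
  | zero => exact ⟨hx₀, hy₀, fun _ _ => measurable_const⟩
  | succ t ih =>
    obtain ⟨hx, hy, hq⟩ := ih
    set S := fun t ω => algorithmRun J f θs W α (x₀ ω) (y₀ ω) (fun s => ε s ω) t with hS
    have hxi : ∀ i, Measurable fun ω => (S t ω).x i := fun i => (measurable_pi_apply i).comp hx
    have hyi : ∀ i, Measurable fun ω => (S t ω).y i := fun i => (measurable_pi_apply i).comp hy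
    have hnum : ∀ i θ, Measurable fun ω =>
        f i ((S t ω).y i) ((S t ω).x i) θ ^ α t * (S t ω).q i θ := fun i θ =>
      (((hf.measurable_prod h1 i θ).comp ((hxi i).prodMk (hyi i))).pow_const _).mul (hq i θ)
    have hb : ∀ i θ, Measurable fun ω => fractionalPosterior f (α t) (S t ω) i θ := fun i θ =>
      (hnum i θ).div (Finset.measurable_fun_sum _ fun θ' _ => hnum i θ')
    have hexp : ∀ i θ, Measurable fun ω =>
        Real.exp (∑ j, W i j * Real.log (fractionalPosterior f (α t) (S t ω) j θ)) := fun i θ =>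
      (Finset.measurable_fun_sum _ fun j _ => (hb j θ).log.const_mul _).exp
    have hq' : ∀ i θ, Measurable fun ω => (S (t + 1) ω).q i θ := fun i θ =>
      (hexp i θ).div (Finset.measurable_fun_sum _ fun θ' _ => hexp i θ')
    have hx' : ∀ i, Measurable fun ω => (S (t + 1) ω).x i := by
      intro i
      simp only [hS, algorithmRun_x_succ h4]
      refine Finset.measurable_fun_sum _ fun j _ => ((hxi j).sub (Measurable.const_mul
        (Finset.measurable_fun_sum _ fun θ _ => ?_) _)).const_mul _
      exact ((h4.stronglyMonotoneLipschitz j θ).continuous.measurable.comp (hxi j)).mul (hq' j θ)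
    refine ⟨measurable_pi_iff.2 hx', measurable_pi_iff.2 fun i => ?_, hq'⟩
    exact ((h4.differentiable i θs).continuous.measurable.comp (hx' i)).add
      ((measurable_pi_apply i).comp (hε (t + 1)))

/-- The centred log-likelihood ratios have almost surely convergent weighted sums. -/
theorem ae_exists_tendsto_sum_logRatio {μ : Measure Ω} [IsProbabilityMeasure μ]
    {S : ℕ → Ω → AgentState N Θ} (hx : ∀ t, Measurable fun ω => (S t ω).x)
    (hy : ∀ t, Measurable fun ω => (S t ω).y) (hf : IsLikelihood f) (h1 : BoundedBelief f)
    (hdata : DataFollowLikelihood μ f θs S) (hα : Summable fun t => α t ^ 2) (j : Fin N) (θ : Θ) :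
    ∀ᵐ ω ∂μ, ∃ l, Tendsto (fun n => ∑ t ∈ Finset.range n, α t *
      (Real.log (f j ((S t ω).y j) ((S t ω).x j) θ / f j ((S t ω).y j) ((S t ω).x j) θs)
        + densityKL (fun y => f j y ((S t ω).x j) θs) (fun y => f j y ((S t ω).x j) θ)))
      atTop (𝓝 l) := by
  obtain ⟨B, hB0, hB⟩ := h1.bounded
  set g : ℝ → ℝ → ℝ := fun v x => Real.log (f j v x θ / f j v x θs)
    + densityKL (fun y => f j y x θs) (fun y => f j y x θ) with hg
  have hgm : Measurable fun z : ℝ × ℝ => g z.2 z.1 :=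
    (hf.measurable_logRatio h1 j θ θs).add ((hf.measurable_densityKL h1 j θs θ).comp measurable_fst)
  have hgC : ∀ v x, |g v x| ≤ B + B := fun v x =>
    (abs_add_le _ _).trans (add_le_add (hB j θ θs x v).le (hf.abs_densityKL_le hB j x θs θ))
  -- Under the true density the log-ratio has mean minus the divergence, which `g` adds back.
  have hg0 : ∀ x, ∫ v, f j v x θs * g v x = 0 := by
    intro x
    set D := densityKL (fun y => f j y x θs) (fun y => f j y x θ) with hD
    have heq : ∀ v, f j v x θs * g v x
        = f j v x θs * D - f j v x θs * Real.log (f j v x θs / f j v x θ) := by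
      intro v
      have : Real.log (f j v x θ / f j v x θs) = -Real.log (f j v x θs / f j v x θ) := by
        rw [← Real.log_inv, inv_div]
      simp only [hg, this]
      ring
    simp only [heq]
    rw [integral_sub ((hf.integrable j x θs).mul_const D) (hf.integrable_mul_log h1 j x θs θ),
      integral_mul_const, hf.integral_eq_one, one_mul]
    exact sub_self D
  set ℱ : Filtration ℕ ‹MeasurableSpace Ω› :=
    ⟨historyBefore S, historyBefore_mono S, historyBefore_le hx hy⟩ with hℱ
  -- the law of the initial data is arbitrary, so the first term is left out
  set d : ℕ → Ω → ℝ := fun t ω => if t = 0 then 0 else g ((S t ω).y j) ((S t ω).x j) with hd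
  have hlim := ae_exists_tendsto_sum_of_condExp_eq_zero (μ := μ) (ℱ := ℱ) (d := d) (α := α)
    (C := B + B) ?_ ?_ ?_ hα
  · filter_upwards [hlim] with ω ⟨l, hl⟩
    refine ⟨l + α 0 * g ((S 0 ω).y j) ((S 0 ω).x j), (tendsto_add_atTop_iff_nat 1).1 ?_⟩
    have hl' := ((tendsto_add_atTop_iff_nat 1).2 hl).add_const
      (α 0 * g ((S 0 ω).y j) ((S 0 ω).x j))
    refine hl'.congr fun n => ?_
    rw [Finset.sum_range_succ', Finset.sum_range_succ' _ n]
    simp [hd, hg]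
  · intro t
    by_cases ht : t = 0
    · simp only [hd, ht, if_true]
      exact stronglyMeasurable_const
    · simp only [hd, ht, if_false]
      have hxt : Measurable[historyBefore S (t + 1)] fun ω => (S t ω).x j :=
        (measurable_x_historyBefore S t j).mono (historyBefore_mono S t.le_succ) le_rfl
      exact (hgm.comp (hxt.prodMk (measurable_y_historyBefore S t j))).stronglyMeasurable
  · intro t ω
    by_cases ht : t = 0
    · simp only [hd, ht, if_true, abs_zero]
      linarith
    · simp only [hd, ht, if_false]
      exact hgC _ _
  · intro t
    by_cases ht : t = 0
    · have : d t = 0 := by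
        ext ω
        simp [hd, ht]
      rw [this, condExp_zero]
    · have : d t = fun ω => g ((S t ω).y j) ((S t ω).x j) := by
        ext ω
        simp [hd, ht]
      rw [this]
      exact condExp_eq_zero_of_condDensity (p := fun v x => f j v x θs)
        (historyBefore_le hx hy t) (measurable_x_historyBefore S t j)
        ((measurable_pi_apply j).comp (hy t)) (hf.measurable_prod h1 j θs)
        (fun v x => (hf.pos j v x θs).le) (fun x => hf.integrable j x θs)
        (fun A hA => hdata t (Nat.one_le_iff_ne_zero.2 ht) j A hA) hgm hgC hg0

end RandomRun

theorem theorem4 {N : ℕ} {Θ : Type*} [Fintype Θ]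
    (J : Fin N → ℝ → Θ → ℝ) (f : Fin N → ℝ → ℝ → Θ → ℝ) (θs : Θ)
    (G : SimpleGraph (Fin N)) (W : Matrix (Fin N) (Fin N) ℝ) (α : ℕ → ℝ) (m L : ℝ)
    {Ω : Type*} [MeasurableSpace Ω] (μ : Measure Ω) [IsProbabilityMeasure μ]
    (x₀ y₀ : Ω → Fin N → ℝ) (ε : ℕ → Ω → Fin N → ℝ)
    (hx₀ : Measurable x₀) (hy₀ : Measurable y₀) (hε : ∀ t, Measurable (ε t))
    (hf : IsLikelihood f)
    (hdata : DataFollowLikelihood μ f θs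
      (fun t ω => algorithmRun J f θs W α (x₀ ω) (y₀ ω) (fun s => ε s ω) t))
    (h1 : BoundedBelief f)
    (h2 : NetworkAssumption G W)
    (h3 : StepsizePolicy α)
    (h4 : CostAssumption J m L)
    (h5 : IdentifiableParameter f θs)
    (hα : α =O[atTop] fun t : ℕ => 1 / (t : ℝ)) :
    ∃ xs : ℝ,
      (∀ x, globalCost J θs xs ≤ globalCost J θs x) ∧
      (∀ x', (∀ x, globalCost J θs x' ≤ globalCost J θs x) → x' = xs) ∧
      ∀ᵐ ω ∂μ, ∀ i, Tendsto
        (fun t => (algorithmRun J f θs W α (x₀ ω) (y₀ ω) (fun s => ε s ω) t).x i)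
        atTop (𝓝 xs) := by
  have hN : 0 < N := Fin.pos_iff_nonempty.2 h2.connected.nonempty
  have hmon := h4.stronglyMonotoneLipschitz_average hN θs
  obtain ⟨xs, hxs⟩ := hmon.exists_eq_zero h4.pos
  obtain ⟨hmin, huniq⟩ := hmon.isMin_of_deriv h4.pos (h4.hasDerivAt_globalCost θs) hxs
  refine ⟨xs, hmin, huniq, ?_⟩
  have hmeas := measurable_algorithmRun (θs := θs) (W := W) (α := α) hx₀ hy₀ hε hf h1 h4
  -- With finitely many agents and parameters, a single null set serves them all.
  have hconv := ae_all_iff.2 fun j => ae_all_iff.2 fun θ =>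
    ae_exists_tendsto_sum_logRatio (fun t => (hmeas t).1) (fun t => (hmeas t).2.1) hf h1 hdata
      h3.sum_sq j θ
  filter_upwards [hconv] with ω hω i
  exact tendsto_algorithmRun_x h2 h3 h4 hxs (fun θ hθ j =>
    tendsto_algorithmRun_q_zero hf h1 h2 h3 h4 h5 hθ (fun k => hω k θ) j) i
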